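/- Let $X$ be a compact complex manifold of dimension $n$ with a Kähler form $\omega$, let $E\to X$ be a holomorphic vector bundle with a Hermitian metric $h$, and let $F=F(h)$ be the curvature of the Chern connection. Let $\rho=(\rho_0,\dots,\rho_n)$ be a stability vector (non-zero complex numbers with $\operatorname{Im}\rho_n>0$ and $\operatorname{Im}(\rho_d/\rho_{d+1})>0$ for $0\le d<n$), and let $\tilde U=\sum_m\tilde U_m$ be a closed real differential form with $\tilde U_0=1$. Let $\tilde Z(h)$ be the $(n,n)$-component of $$\sum_{d=0}^n \rho_d\,\omega^d\wedge \exp\!\Big(\tfrac{i}{2\pi}F(h)\Big)\wedge\tilde U ,$$ let $Z(E)=\int_X\operatorname{tr}\tilde Z(h)$, assume $Z(E)\ne0$, and let $\varphi=\arg Z(E)$, a constant independent of $h$. The $Z$-critical equation is $$D(h)=\frac{\operatorname{Im}\big(e^{-i\varphi}\tilde Z(h)\big)}{\omega^n}=0,$$ where $\operatorname{Im}$ denotes the skew-Hermitian component of an endomorphism with respect to $h$. It is called elliptic at $h$ if the linearisation of $D$ at $h$ (with $\varphi$ fixed), a second-order linear operator from $h$-Hermitian to $h$-skew-Hermitian sections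 of $\operatorname{End}E$, has invertible principal symbol at every non-zero real covector. Let $\alpha(h,-)$ be the expression obtained from $\tilde Z(h)$ by replacing every power $F^j$ by $\sum_{\ell=1}^j F^{\ell-1}\wedge(-)\wedge F^{j-\ell}$, and let $\operatorname{Im}(e^{-i\varphi}\alpha(h,-))$ be its imaginary part, in which the forms $\omega$, $\tilde U$ and $\tfrac{i}{2\pi}F$ are real, so that each coefficient $e^{-i\varphi}\rho_d$ is replaced by its imaginary part. For homogeneous $\operatorname{End}E$-valued forms put $$[B_1,\dots,B_m]_{\mathrm{sym}}=\frac1{m!}\sum_{\sigma\in S_m}\epsilon(\sigma)\,B_{\sigma(1)}\cdots B_{\sigma(m)},$$ where $\epsilon(\sigma)=\pm1$ is the Koszul sign, coming from interchanging the form parts of odd degree. The metric $h$ is called a subsolution if for every $p\in X$ and every non-zero $u\in \Lambda^{0,1}T_p^*X\otimes\operatorname{End}E_p$ the $(n,n)$-form at $p$ $$\operatorname{tr}\big[\operatorname{Im}(e^{-i\varphi}\alpha(h,-)),u,u^*\big]_{\mathrm{sym}}$$ is non-zero; here $u^*$ is the adjoint with respect to $h$, and in each term the $j-1$ factors $F$,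 together with $u$ and $u^*$, are the entries that are symmetrised. If $h$ is a subsolution, then the $Z$-critical equation is elliptic at $h$. If moreover $\operatorname{rk}E=1$, then conversely ellipticity at $h$ implies that $h$ is a subsolution; thus in rank one the $Z$-critical equation is elliptic at $h$ if and only if $h$ is a subsolution. -/

import Mathlib

open scoped Manifold ContDiff Bundle Matrix

noncomputable section

namespace ZCritical

/-! ## Exterior algebra of the complexified cotangent space of `ℂⁿ` -/

/-- Complex-valued real-linear forms on `ℂⁿ`: the complexified cotangent space at a point. -/
abbrev Covector (n : ℕ) : Type := (Fin n → ℂ) →ₗ[ℝ] ℂ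

/-- The complex-valued exterior forms at a point of an `n`-dimensional complex manifold; the
product is the wedge product. -/
abbrev Ext (n : ℕ) : Type := ExteriorAlgebra ℂ (Covector n)

/-- A covector as a form of degree one. -/
def oneForm {n : ℕ} (w : Covector n) : Ext n := ExteriorAlgebra.ι ℂ w

/-- The complex conjugate `v ↦ conj (w v)` of a covector. -/
def conjCovector {n : ℕ} (w : Covector n) : Covector n :=
  Complex.conjAe.toLinearMap ∘ₗ w

/-- Covectors of type `(0,1)`: the conjugate-linear ones. -/
def IsZeroOne {n : ℕ} (w : Covector n) : Prop :=
  ∀ v : Fin n → ℂ, w (Complex.I • v) = -Complex.I * w v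

/-- `dz_j`. -/
def dz {n : ℕ} (j : Fin n) : Covector n where
  toFun v := v j
  map_add' _ _ := rfl
  map_smul' _ _ := rfl

/-- `d\bar z_j`. -/
def dzbar {n : ℕ} (j : Fin n) : Covector n := conjCovector (dz j)

/-- The oriented real basis `∂/∂x₁, ∂/∂y₁, …, ∂/∂xₙ, ∂/∂yₙ` of `ℂⁿ`. -/
def realBasis {n : ℕ} (k : Fin (n * 2)) : Fin n → ℂ :=
  Pi.single (finProdFinEquiv.symm k).1
    (if (finProdFinEquiv.symm k).2 = 0 then 1 else Complex.I)

/-- The dual basis `dx₁, dy₁, …, dxₙ, dyₙ`. -/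
def dualBasis {n : ℕ} (k : Fin (n * 2)) : Covector n where
  toFun v :=
    (((if (finProdFinEquiv.symm k).2 = 0 then (v (finProdFinEquiv.symm k).1).re
      else (v (finProdFinEquiv.symm k).1).im : ℝ)) : ℂ)
  map_add' v w := by split_ifs <;> simp
  map_smul' c v := by split_ifs <;> simp

/-- The element `(1/m!) ∑ η(e_{k₁}, …, e_{k_m}) e^{k₁} ∧ … ∧ e^{k_m}` of the exterior algebra given
by a real alternating form `η`. -/
def toExt {n m : ℕ} (η : (Fin n → ℂ) [⋀^Fin m]→L[ℝ] ℝ) : Ext n :=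
  ((m.factorial : ℂ)⁻¹) • ∑ k : Fin m → Fin (n * 2),
    ((η fun i => realBasis (k i) : ℝ) : ℂ) •
      ExteriorAlgebra.ιMulti ℂ m fun i => dualBasis (k i)

/-- The coefficient of the top-degree component of an exterior form with respect to
`dx₁ ∧ dy₁ ∧ … ∧ dxₙ ∧ dyₙ`. Components of lower degree are discarded, so this also carries
out the selection of the `(n,n)`-component. -/
def topCoeff {n : ℕ} : Ext n →ₗ[ℂ] ℂ :=
  ExteriorAlgebra.liftAlternating
    (Pi.single (M := fun i : ℕ => Covector n [⋀^Fin i]→ₗ[ℂ] ℂ) (n * 2)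
      ((Matrix.detRowAlternating (R := ℂ) (n := Fin (n * 2))).compLinearMap
        (LinearMap.pi fun k =>
          { toFun := fun w : Covector n => w (realBasis k)
            map_add' := fun _ _ => rfl
            map_smul' := fun _ _ => rfl })))

/-- The symmetrisation `[B₁, …, B_m]_sym` of elements of degrees `deg` of a graded algebra: the
average over all orders of multiplication, with the Koszul sign that arises when elements of odd
degree pass each other. -/
def symBracket {A : Type*} [Ring A] [Algebra ℂ A] {m : ℕ} (deg : Fin m → ℕ) (B : Fin m → A) : A :=
  ((m.factorial : ℂ)⁻¹) • ∑ σ : Equiv.Perm (Fin m),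
    (∏ i : Fin m, ∏ j : Fin m,
      if i < j ∧ σ j < σ i then (-1 : ℂ) ^ (deg (σ i) * deg (σ j)) else 1) •
      (List.ofFn fun i => B (σ i)).prod

/-! ## Differential forms on a complex manifold -/

section Manifold

variable {n : ℕ} {X : Type*} [TopologicalSpace X] [ChartedSpace (Fin n → ℂ) X]

/-- A real form of degree `m` on `X`. The tangent space at `x` is identified with `ℂⁿ` through the
preferred chart at `x`, as for Mathlib's `TangentSpace`. -/
abbrev RealForm (n : ℕ) (X : Type*) (m : ℕ) : Type _ :=
  X → (Fin n → ℂ) [⋀^Fin m]→L[ℝ] ℝ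

/-- The coordinate expression of a form in the preferred chart at `p`. -/
def RealForm.inChart {m : ℕ} (η : RealForm n X m) (p : X) (z : Fin n → ℂ) :
    (Fin n → ℂ) [⋀^Fin m]→L[ℝ] ℝ :=
  (η ((chartAt (Fin n → ℂ) p).symm z)).compContinuousLinearMap
    (fderiv ℝ (chartAt (Fin n → ℂ) ((chartAt (Fin n → ℂ) p).symm z) ∘
      (chartAt (Fin n → ℂ) p).symm) z)

/-- `C^∞` forms. -/
def RealForm.IsSmooth {m : ℕ} (η : RealForm n X m) : Prop :=
  ∀ p : X, ContDiffOn ℝ ∞ (η.inChart p) (chartAt (Fin n → ℂ) p).target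

/-- Closed forms: `dη = 0`. -/
def RealForm.IsClosed {m : ℕ} (η : RealForm n X m) : Prop :=
  ∀ p : X, ∀ z ∈ (chartAt (Fin n → ℂ) p).target, extDeriv (η.inChart p) z = 0

/-- A Kähler form: a smooth closed real two-form of type `(1,1)` that is positive. -/
structure IsKahlerForm (κ : RealForm n X 2) : Prop where
  smooth : κ.IsSmooth
  closed : κ.IsClosed
  type_one_one : ∀ x v w, κ x ![Complex.I • v, Complex.I • w] = κ x ![v, w]
  pos : ∀ x v, v ≠ 0 → 0 < κ x ![v, Complex.I • v]

/-- The data of a polynomial central charge (at `k = 1`) together with the chosen representatives: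
a stability vector `ρ`, a Kähler form `κ`, and a closed real form `U` of mixed degree whose
component of degree zero is `1`. -/
structure ChargeData (n : ℕ) (X : Type*) [TopologicalSpace X] [ChartedSpace (Fin n → ℂ) X] where
  ρ : Fin (n + 1) → ℂ
  ρ_ne_zero : ∀ d, ρ d ≠ 0
  ρ_last : 0 < (ρ (Fin.last n)).im
  ρ_ratio : ∀ d : Fin n, 0 < (ρ d.castSucc / ρ d.succ).im
  κ : RealForm n X 2
  kahler : IsKahlerForm κ
  U : ∀ m : ℕ, RealForm n X m
  U_smooth : ∀ m, (U m).IsSmooth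
  U_closed : ∀ m, (U m).IsClosed
  U_zero : ∀ x v, U 0 x v = 1

/-- The Kähler form at `x` as an element of the exterior algebra. -/
def ChargeData.kahlerAt (Ω : ChargeData n X) (x : X) : Ext n := toExt (Ω.κ x)

/-- The total unipotent form at `x`. -/
def ChargeData.unipotentAt (Ω : ChargeData n X) (x : X) : Ext n :=
  ∑ m ∈ Finset.range (n * 2 + 1), toExt (Ω.U m x)

theorem exists_chart_partition [T2Space X] [CompactSpace X] :
    ∃ f : PartitionOfUnity X X Set.univ, f.IsSubordinate fun p => (chartAt (Fin n → ℂ) p).source :=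
  PartitionOfUnity.exists_isSubordinate isClosed_univ _
    (fun p => (chartAt (Fin n → ℂ) p).open_source)
    fun x _ => Set.mem_iUnion.2 ⟨x, mem_chart_source _ x⟩

/-- The integral over `X` of the complex-valued top-degree form whose value at `x` is
`c x • dx₁ ∧ dy₁ ∧ … ∧ dxₙ ∧ dyₙ` in the preferred chart at `x`, through a partition of unity
subordinate to the charts. -/
def integralTop [T2Space X] [CompactSpace X] (c : X → ℂ) : ℂ :=
  ∑ᶠ p : X, ∫ z in (chartAt (Fin n → ℂ) p).target,
    ((Classical.choose (exists_chart_partition (n := n) (X := X)) p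
        ((chartAt (Fin n → ℂ) p).symm z) : ℝ) : ℂ) *
      (((fderiv ℝ (chartAt (Fin n → ℂ) ((chartAt (Fin n → ℂ) p).symm z) ∘
        (chartAt (Fin n → ℂ) p).symm) z).det : ℝ) : ℂ) *
      c ((chartAt (Fin n → ℂ) p).symm z)

/-! ## Holomorphic vector bundles, Hermitian metrics and the Chern curvature -/

/-- `∂g/∂z_j` at `z`. -/
def wirt (j : Fin n) (g : (Fin n → ℂ) → ℂ) (z : Fin n → ℂ) : ℂ :=
  (1 / 2) * (fderiv ℝ g z (Pi.single j 1) - Complex.I * fderiv ℝ g z (Pi.single j Complex.I))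

/-- `∂g/∂\bar z_j` at `z`. -/
def wirtBar (j : Fin n) (g : (Fin n → ℂ) → ℂ) (z : Fin n → ℂ) : ℂ :=
  (1 / 2) * (fderiv ℝ g z (Pi.single j 1) + Complex.I * fderiv ℝ g z (Pi.single j Complex.I))

variable {r : ℕ} {V : X → Type*} [∀ x, AddCommGroup (V x)] [∀ x, Module ℂ (V x)]
  [∀ x, TopologicalSpace (V x)] [TopologicalSpace (Bundle.TotalSpace (Fin r → ℂ) V)]
  [FiberBundle (Fin r → ℂ) V]

/-- The local frame of `V` given by the preferred trivialization at `p`; it is holomorphic when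
`V` is a holomorphic bundle. -/
def frame (p : X) (a : Fin r) (x : X) : V x :=
  (trivializationAt (Fin r → ℂ) V p).symm x (Pi.single a 1)

variable (V) in
/-- The part of the preferred chart at `p` over which the preferred frame at `p` is defined. -/
def coordDomain (p : X) : Set (Fin n → ℂ) :=
  (chartAt (Fin n → ℂ) p).target ∩
    (chartAt (Fin n → ℂ) p).symm ⁻¹' (trivializationAt (Fin r → ℂ) V p).baseSet

/-- The Gram matrix `H_{ab} = h(s_a, s_b)` of a sesquilinear form (conjugate-linear in the first
variable) in the frame at `p`, in the coordinates at `p`. -/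
def gram (h : ∀ x, V x →ₗ⋆[ℂ] V x →ₗ[ℂ] ℂ) (p : X) (z : Fin n → ℂ) : Matrix (Fin r) (Fin r) ℂ :=
  Matrix.of fun a b => h ((chartAt (Fin n → ℂ) p).symm z)
    (frame p a ((chartAt (Fin n → ℂ) p).symm z)) (frame p b ((chartAt (Fin n → ℂ) p).symm z))

/-- The Gram matrix at the point `p` itself. -/
def gramAt (h : ∀ x, V x →ₗ⋆[ℂ] V x →ₗ[ℂ] ℂ) (p : X) : Matrix (Fin r) (Fin r) ℂ :=
  gram h p (chartAt (Fin n → ℂ) p p)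

/-- The matrix of an endomorphism of `V` in the frame at `p`, in the coordinates at `p`. -/
def endMatrix (s : ∀ x, V x →ₗ[ℂ] V x) (p : X) (z : Fin n → ℂ) : Matrix (Fin r) (Fin r) ℂ :=
  Matrix.of fun a b => ((trivializationAt (Fin r → ℂ) V p)
    ⟨(chartAt (Fin n → ℂ) p).symm z, s ((chartAt (Fin n → ℂ) p).symm z)
      (frame p b ((chartAt (Fin n → ℂ) p).symm z))⟩).2 a

/-- A smooth Hermitian metric on `V`. -/
structure IsHermitianMetric (h : ∀ x, V x →ₗ⋆[ℂ] V x →ₗ[ℂ] ℂ) : Prop where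
  conj_symm : ∀ x v w, starRingEnd ℂ (h x v w) = h x w v
  pos : ∀ x v, v ≠ 0 → 0 < (h x v v).re
  smooth : ∀ (p : X) (a b : Fin r),
    ContDiffOn ℝ ∞ (fun z => gram (n := n) h p z a b) (coordDomain (r := r) V p)

/-- A smooth section of the bundle of `h`-Hermitian endomorphisms of `V`. -/
structure IsHermitianSection (h : ∀ x, V x →ₗ⋆[ℂ] V x →ₗ[ℂ] ℂ) (s : ∀ x, V x →ₗ[ℂ] V x) :
    Prop where
  selfAdjoint : ∀ x v w, h x (s x v) w = h x v (s x w)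
  smooth : ∀ (p : X) (a b : Fin r),
    ContDiffOn ℝ ∞ (fun z => endMatrix (n := n) s p z a b) (coordDomain (r := r) V p)

/-- The `dz_j`-component of the connection matrix `H⁻¹ ∂H` of the Chern connection. -/
def connMatrix (h : ∀ x, V x →ₗ⋆[ℂ] V x →ₗ[ℂ] ℂ) (p : X) (j : Fin n) (z : Fin n → ℂ) :
    Matrix (Fin r) (Fin r) ℂ :=
  (gram h p z)⁻¹ * Matrix.of fun a b => wirt j (fun w => gram h p w a b) z

/-- The curvature `F(h) = \bar∂(H⁻¹ ∂H)` of the Chern connection at `p`, in the frame at `p`. -/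
def curvature (h : ∀ x, V x →ₗ⋆[ℂ] V x →ₗ[ℂ] ℂ) (p : X) : Matrix (Fin r) (Fin r) (Ext n) :=
  Matrix.of fun a b => ∑ k : Fin n, ∑ j : Fin n,
    wirtBar k (fun z => connMatrix h p j z a b) (chartAt (Fin n → ℂ) p p) •
      (oneForm (dzbar k) * oneForm (dz j))

/-! ## The central charge and the Z-critical operator -/

/-- The Chern-Weil form `ch(E) = exp(iF/2π)`, with values in the endomorphisms. -/
def chernCharacterForm (h : ∀ x, V x →ₗ⋆[ℂ] V x →ₗ[ℂ] ℂ) (p : X) :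
    Matrix (Fin r) (Fin r) (Ext n) :=
  ∑ j ∈ Finset.range (n + 1),
    ((Complex.I / (2 * Real.pi)) ^ j / (j.factorial : ℂ)) • curvature h p ^ j

/-- The `(n,n)`-component of `∑_d ρ_d ω^d ∧ ch(E) ∧ U` at `p`, as the matrix of its coefficients
with respect to `dx₁ ∧ dy₁ ∧ … ∧ dxₙ ∧ dyₙ`. -/
def zForm (Ω : ChargeData n X) (h : ∀ x, V x →ₗ⋆[ℂ] V x →ₗ[ℂ] ℂ) (p : X) :
    Matrix (Fin r) (Fin r) ℂ :=
  (∑ d : Fin (n + 1), Ω.ρ d •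
    ((Ω.kahlerAt p ^ (d : ℕ) * Ω.unipotentAt p) • chernCharacterForm (n := n) (r := r) h p)).map topCoeff

/-- `Z(E) = ∫_X tr Z̃(E)`. -/
def centralCharge [T2Space X] [CompactSpace X] (Ω : ChargeData n X)
    (h : ∀ x, V x →ₗ⋆[ℂ] V x →ₗ[ℂ] ℂ) : ℂ :=
  integralTop (n := n) fun x => (zForm (n := n) (r := r) Ω h x).trace

/-- The phase `φ(E) = arg Z(E)`. It is a topological constant, independent of `h`. -/
def phase [T2Space X] [CompactSpace X] (Ω : ChargeData n X)
    (h : ∀ x, V x →ₗ⋆[ℂ] V x →ₗ[ℂ] ℂ) : ℝ :=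
  (centralCharge (r := r) Ω h).arg

/-- The imaginary part of an endomorphism: its anti-self-adjoint component with respect to the
Hermitian form with Gram matrix `H`. -/
def imPart (H M : Matrix (Fin r) (Fin r) ℂ) : Matrix (Fin r) (Fin r) ℂ :=
  (1 / 2 : ℂ) • (M - H⁻¹ * Mᴴ * H)

/-- The Z-critical operator `D(h) = Im(e^{-iφ} Z̃(E)(h)) / ω^n` at `p`, for a constant `φ`. -/
def zOperator (Ω : ChargeData n X) (φ : ℝ) (h : ∀ x, V x →ₗ⋆[ℂ] V x →ₗ[ℂ] ℂ) (p : X) :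
    Matrix (Fin r) (Fin r) ℂ :=
  (topCoeff (Ω.kahlerAt p ^ n))⁻¹ •
    imPart (gramAt (n := n) h p) (Complex.exp (-(Complex.I * φ)) • zForm Ω h p)

/-- The Hermitian form `h(·, (1 + t s)·)`, a Hermitian metric for small `t` when `s` is
`h`-Hermitian; it agrees to first order in `t` with `exp(t s) · h`. -/
def deform (h : ∀ x, V x →ₗ⋆[ℂ] V x →ₗ[ℂ] ℂ) (s : ∀ x, V x →ₗ[ℂ] V x) (t : ℝ) :
    ∀ x, V x →ₗ⋆[ℂ] V x →ₗ[ℂ] ℂ :=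
  fun x => h x + (t : ℂ) • (h x).compl₂ (s x)

/-- The linearisation at `h` of the Z-critical operator, in the direction `s`. -/
def linearisation (Ω : ChargeData n X) (φ : ℝ) (h : ∀ x, V x →ₗ⋆[ℂ] V x →ₗ[ℂ] ℂ)
    (s : ∀ x, V x →ₗ[ℂ] V x) (p : X) : Matrix (Fin r) (Fin r) ℂ :=
  Matrix.of fun a b => deriv (fun t : ℝ => zOperator Ω φ (deform h s t) p a b) 0

/-- The Hermitian endomorphisms with respect to the form with Gram matrix `H`. -/
def hermEnd (H : Matrix (Fin r) (Fin r) ℂ) : Submodule ℝ (Matrix (Fin r) (Fin r) ℂ) where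
  carrier := {M | Mᴴ * H = H * M}
  add_mem' := by
    intro A B hA hB
    simp only [Set.mem_ofPred_eq] at *
    rw [Matrix.conjTranspose_add, add_mul, mul_add, hA, hB]
  zero_mem' := by simp
  smul_mem' := by
    intro c A hA
    simp only [Set.mem_ofPred_eq] at *
    rw [Matrix.conjTranspose_smul, star_trivial, smul_mul_assoc, mul_smul_comm, hA]

/-- The skew-Hermitian endomorphisms with respect to the form with Gram matrix `H`. -/
def skewEnd (H : Matrix (Fin r) (Fin r) ℂ) : Submodule ℝ (Matrix (Fin r) (Fin r) ℂ) where
  carrier := {M | Mᴴ * H = -(H * M)}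
  add_mem' := by
    intro A B hA hB
    simp only [Set.mem_ofPred_eq] at *
    rw [Matrix.conjTranspose_add, add_mul, mul_add, hA, hB, neg_add]
  zero_mem' := by simp
  smul_mem' := by
    intro c A hA
    simp only [Set.mem_ofPred_eq] at *
    rw [Matrix.conjTranspose_smul, star_trivial, smul_mul_assoc, mul_smul_comm, hA, smul_neg]

/-- `σ` is the principal symbol at the real covector `ξ` at `p` of the second-order operator `P`
from Hermitian sections to skew-Hermitian sections: `P(f² s)(p) = 2 σ(s(p))` for all smooth real
functions `f` with `f(p) = 0` and `df_p = ξ`, and all smooth Hermitian sections `s`. -/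
def IsPrincipalSymbol (h : ∀ x, V x →ₗ⋆[ℂ] V x →ₗ[ℂ] ℂ)
    (P : (∀ x, V x →ₗ[ℂ] V x) → X → Matrix (Fin r) (Fin r) ℂ) (p : X)
    (ξ : (Fin n → ℂ) →L[ℝ] ℝ)
    (σ : hermEnd (gramAt (n := n) (r := r) h p) →ₗ[ℝ] skewEnd (gramAt (n := n) (r := r) h p)) :
    Prop :=
  ∀ (f : X → ℝ) (s : ∀ x, V x →ₗ[ℂ] V x)
    (v : hermEnd (gramAt (n := n) (r := r) h p)),
    ContMDiff 𝓘(ℝ, Fin n → ℂ) 𝓘(ℝ, ℝ) ∞ f → f p = 0 →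
    fderiv ℝ (f ∘ (chartAt (Fin n → ℂ) p).symm) (chartAt (Fin n → ℂ) p p) = ξ →
    IsHermitianSection (n := n) (r := r) h s →
    endMatrix s p (chartAt (Fin n → ℂ) p p) = (v : Matrix (Fin r) (Fin r) ℂ) →
    P (fun x => ((f x : ℂ) ^ 2) • s x) p = (2 : ℝ) • (σ v : Matrix (Fin r) (Fin r) ℂ)

/-- The Z-critical equation is elliptic at `h`: the principal symbol of its linearisation at `h`,
with the phase held fixed, is invertible at every nonzero real covector. -/
def IsEllipticAt [T2Space X] [CompactSpace X] (Ω : ChargeData n X)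
    (h : ∀ x, V x →ₗ⋆[ℂ] V x →ₗ[ℂ] ℂ) : Prop :=
  ∀ (p : X) (ξ : (Fin n → ℂ) →L[ℝ] ℝ), ξ ≠ 0 →
    ∃ σ : hermEnd (gramAt (n := n) (r := r) h p) →ₗ[ℝ] skewEnd (gramAt (n := n) (r := r) h p),
      IsPrincipalSymbol h (linearisation Ω (phase (r := r) Ω h) h) p ξ σ ∧ Function.Bijective σ

/-! ## Subsolutions -/

/-- The adjoint `u* = H⁻¹ \bar uᵀ H` of an endomorphism-valued one-form at a point. -/
def adjointOneForm (H : Matrix (Fin r) (Fin r) ℂ) (u : Matrix (Fin r) (Fin r) (Covector n)) :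
    Matrix (Fin r) (Fin r) (Covector n) :=
  Matrix.of fun a b => ∑ c, ∑ d, (H⁻¹ a c * H d b) • conjCovector (u d c)

/-- The `(n,n)`-form `tr [Im(e^{-iφ} α(h, -)), u, u*]_sym` at `p`, as its coefficient with respect
to `dx₁ ∧ dy₁ ∧ … ∧ dxₙ ∧ dyₙ`. Here `α(h, -)` arises from `Z̃(E)(h)` when each power `F^(i+1)` is
replaced by the sum of the `i + 1` words in `i` letters `F` and one empty slot; each of these words
becomes, after symmetrisation, the bracket of `i` copies of `F`, `u` and `u*`. As `ω`, `U` and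
`iF/2π` are real, the imaginary part of `e^{-iφ} α(h, -)` is that of the coefficients
`e^{-iφ} ρ_d`. -/
def subsolutionForm (Ω : ChargeData n X) (φ : ℝ) (h : ∀ x, V x →ₗ⋆[ℂ] V x →ₗ[ℂ] ℂ) (p : X)
    (u : Matrix (Fin r) (Fin r) (Covector n)) : ℂ :=
  topCoeff (∑ d : Fin (n + 1), ∑ i ∈ Finset.range n,
    ((((Complex.exp (-(Complex.I * φ)) * Ω.ρ d).im : ℝ) : ℂ) *
      ((Complex.I / (2 * Real.pi)) ^ (i + 1) / ((i + 1).factorial : ℂ))) •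
      (Ω.kahlerAt p ^ (d : ℕ) * Ω.unipotentAt p *
        ∑ _ℓ : Fin (i + 1),
          (symBracket (Fin.append (fun _ : Fin i => 2) ![1, 1])
            (Fin.append (fun _ : Fin i => curvature h p)
              ![u.map oneForm, (adjointOneForm (gramAt (n := n) h p) u).map oneForm])).trace))

/-- The subsolution condition: `tr [Im(e^{-iφ(E)} α(h, -)), u, u*]_sym` does not vanish at any point
`p`, for any nonzero `End(E_p)`-valued `(0,1)`-covector `u` at `p`. -/
def IsSubsolution [T2Space X] [CompactSpace X] (Ω : ChargeData n X)
    (h : ∀ x, V x →ₗ⋆[ℂ] V x →ₗ[ℂ] ℂ) : Prop :=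
  ∀ (p : X) (u : Matrix (Fin r) (Fin r) (Covector n)), (∀ a b, IsZeroOne (u a b)) → u ≠ 0 →
    subsolutionForm Ω (phase (r := r) Ω h) h p u ≠ 0

end Manifold

end ZCritical

end

noncomputable section

namespace ZCritical

/-! ## Even forms, conjugation of forms -/

section Forms

variable {n : ℕ}

/-! The principal symbol is computed by moving `h` to `h(·, (1 + t f² s)·)` with `f p = 0`. Because
`f²` vanishes to second order, the Gram matrix and its first derivatives at `p` stay fixed, and the
curvature at `p` changes by exactly `2t w ∧ w̄ ⊗ s(p)`, where `w` is the `(0,1)`-part of `df_p`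
(`centralCurvature_deform`). Since `(w ∧ w̄)² = 0`, each power of `F` changes only by `t` times a
sum of words with one letter `s(p)`. The curvature is skew-Hermitian and `ω`, `U` are real, so the
variation multiplying `ρ_d` is Hermitian, and taking the skew part turns `e^{-iφ} ρ_d` into `i`
times its imaginary part. This gives the explicit symbol `symbolMatrix` (`linearisation_sq_smul`).

The link with subsolutions is the pairing `tr(σ(S) S)` for Hermitian `S`. By cyclicity, the trace of
a word with two letters `S` depends only on the cyclic gap between them. The Koszul sign cancels the
sign of exchanging `w` and `w̄`, and the permutations distribute the gaps uniformly, so symmetrising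
produces the same sum of words (`symBracket_trace`). Hence `tr(σ(S) S)` is a multiple of the
subsolution form at `u = S ⊗ w` (`trace_symbolMatrix_mul`). The multiple is finite and nonzero
because the top power of a positive `(1,1)`-form does not vanish (`topCoeff_pow_ne_zero`).

For a subsolution the symbol is therefore injective, and it is bijective because Hermitian and
skew-Hermitian endomorphisms have the same real dimension. Only the decomposable `u = S ⊗ w` enter
this argument. In rank one every `u` has the form `1 ⊗ w`, and every `(0,1)`-covector `w` comes from
a real covector, so a zero of the subsolution form forces `σ(1) = 0` and contradicts ellipticity. -/

theorem oneForm_mul_swap (a b : Covector n) : oneForm a * oneForm b = -(oneForm b * oneForm a) :=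
  eq_neg_of_add_eq_zero_left (ExteriorAlgebra.ι_add_mul_swap a b)

theorem oneForm_mul_self (a : Covector n) : oneForm a * oneForm a = 0 :=
  ExteriorAlgebra.ι_sq_zero a

/-- On a generator the two sign changes, one for each factor passed, cancel; the commutation then
propagates to sums and products. -/
theorem oneForm_mul_mem_center (a b : Covector n) :
    oneForm a * oneForm b ∈ Subalgebra.center ℂ (Ext n) := by
  rw [Subalgebra.mem_center_iff]
  intro x
  induction x using ExteriorAlgebra.induction with
  | algebraMap c => exact Algebra.commutes c _
  | ι w =>
    change oneForm w * _ = _ * oneForm w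
    rw [← mul_assoc, oneForm_mul_swap w a, neg_mul, mul_assoc, oneForm_mul_swap w b, mul_neg,
      neg_neg, mul_assoc]
  | mul x y hx hy => rw [mul_assoc, hy, ← mul_assoc, hx, mul_assoc]
  | add x y hx hy => rw [add_mul, mul_add, hx, hy]

/-- The forms that commute with all forms; all forms of even degree are among them. -/
abbrev CentralForm (n : ℕ) : Type := Subalgebra.center ℂ (Ext n)

instance : Neg (CentralForm n) := CommRing.toRing.toNeg

theorem CentralForm.commute (c : CentralForm n) (x : Ext n) : (c : Ext n) * x = x * c :=
  ((Subalgebra.mem_center_iff.1 c.2) x).symm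

/-- The wedge product of two covectors. -/
def twoForm (a b : Covector n) : CentralForm n :=
  ⟨oneForm a * oneForm b, oneForm_mul_mem_center a b⟩

theorem twoForm_swap (a b : Covector n) : twoForm a b = -twoForm b a :=
  Subtype.ext (oneForm_mul_swap a b)

/-- This nilpotence makes every expansion in the deformation parameter stop at first order, and it
also reduces the top power of a sum of planes to a single product. -/
theorem twoForm_mul_self (a b : Covector n) : twoForm a b * twoForm a b = 0 := by
  apply Subtype.ext
  change oneForm a * oneForm b * (oneForm a * oneForm b) = 0
  nth_rw 1 [oneForm_mul_swap a b]
  rw [neg_mul, mul_assoc, ← mul_assoc (oneForm a), oneForm_mul_self, zero_mul, mul_zero, neg_zero]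

theorem twoForm_sum_left {ι : Type*} (s : Finset ι) (f : ι → ℂ) (a : ι → Covector n)
    (b : Covector n) : twoForm (∑ k ∈ s, f k • a k) b = ∑ k ∈ s, f k • twoForm (a k) b := by
  apply Subtype.ext
  simp [twoForm, oneForm, Finset.sum_mul]

theorem twoForm_sum_right {ι : Type*} (s : Finset ι) (f : ι → ℂ) (a : ι → Covector n)
    (b : Covector n) : twoForm b (∑ k ∈ s, f k • a k) = ∑ k ∈ s, f k • twoForm b (a k) := by
  apply Subtype.ext
  simp [twoForm, oneForm, Finset.mul_sum]

theorem conjCovector_apply (w : Covector n) (v : Fin n → ℂ) :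
    conjCovector w v = starRingEnd ℂ (w v) := rfl

theorem conjCovector_conjCovector (w : Covector n) : conjCovector (conjCovector w) = w := by
  ext v; simp [conjCovector_apply]

theorem conjCovector_smul (c : ℂ) (w : Covector n) :
    conjCovector (c • w) = starRingEnd ℂ c • conjCovector w := by
  ext v; simp [conjCovector_apply]

theorem conjCovector_add (v w : Covector n) :
    conjCovector (v + w) = conjCovector v + conjCovector w := by
  ext v; simp [conjCovector_apply]

theorem conjCovector_sum {ι : Type*} (s : Finset ι) (f : ι → Covector n) :
    conjCovector (∑ i ∈ s, f i) = ∑ i ∈ s, conjCovector (f i) := by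
  ext v; simp [conjCovector_apply]

theorem conjCovector_dualBasis (k : Fin (n * 2)) :
    conjCovector (dualBasis k) = dualBasis k := by
  ext v
  exact Complex.conj_ofReal _

/-- The exterior algebra with the conjugate complex structure. -/
def ConjExt (n : ℕ) : Type := Ext n

instance : Ring (ConjExt n) := inferInstanceAs (Ring (Ext n))

/-- With scalars acting through their conjugates, conjugation of forms becomes an algebra
homomorphism, so the universal property of the exterior algebra constructs it. -/
instance : Algebra ℂ (ConjExt n) :=
  RingHom.toAlgebra' ((algebraMap ℂ (Ext n)).comp (starRingEnd ℂ))
    fun c x => Algebra.commutes (A := Ext n) (starRingEnd ℂ c) x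

/-- The identity as a map to the conjugate exterior algebra. -/
def toConjExt : Ext n ≃+* ConjExt n := RingEquiv.refl (Ext n)

theorem smul_toConjExt (c : ℂ) (x : Ext n) :
    c • toConjExt x = toConjExt (starRingEnd ℂ c • x) :=
  (Algebra.smul_def (A := ConjExt n) c (toConjExt x)).trans
    (congrArg toConjExt (Algebra.smul_def (A := Ext n) (starRingEnd ℂ c) x).symm)

/-- Complex conjugation of forms as a linear map to the conjugate exterior algebra. -/
def conjExtHom : Ext n →ₐ[ℂ] ConjExt n :=
  ExteriorAlgebra.lift ℂ
    ⟨{  toFun := fun w => toConjExt (oneForm (conjCovector w))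
        map_add' := fun v w => by
          rw [conjCovector_add, oneForm, map_add, map_add]
          rfl
        map_smul' := fun c w => by
          rw [conjCovector_smul, RingHom.id_apply, smul_toConjExt, oneForm, map_smul]
          rfl },
      fun w => by
        change toConjExt _ * toConjExt _ = 0
        rw [← map_mul, oneForm_mul_self, map_zero]⟩

/-- Complex conjugation of forms. -/
def conjExt : Ext n →+* Ext n :=
  (toConjExt (n := n)).symm.toRingHom.comp (conjExtHom (n := n)).toRingHom

theorem toConjExt_conjExt (x : Ext n) : toConjExt (conjExt x) = conjExtHom x := rfl

theorem conjExt_oneForm (w : Covector n) : conjExt (oneForm w) = oneForm (conjCovector w) :=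
  toConjExt.injective (ExteriorAlgebra.lift_ι_apply ℂ _ _ w)

theorem conjExt_smul (c : ℂ) (x : Ext n) : conjExt (c • x) = starRingEnd ℂ c • conjExt x := by
  apply toConjExt.injective
  rw [toConjExt_conjExt, map_smul, ← toConjExt_conjExt, smul_toConjExt]

theorem conjExt_algebraMap (c : ℂ) :
    conjExt (algebraMap ℂ (Ext n) c) = algebraMap ℂ (Ext n) (starRingEnd ℂ c) := by
  rw [Algebra.algebraMap_eq_smul_one, conjExt_smul, map_one, Algebra.algebraMap_eq_smul_one]

theorem conjExt_conjExt (x : Ext n) : conjExt (conjExt x) = x := by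
  induction x using ExteriorAlgebra.induction with
  | algebraMap c => simp [conjExt_algebraMap]
  | ι w =>
    change conjExt (conjExt (oneForm w)) = oneForm w
    rw [conjExt_oneForm, conjExt_oneForm, conjCovector_conjCovector]
  | mul x y hx hy => rw [map_mul, map_mul, hx, hy]
  | add x y hx hy => rw [map_add, map_add, hx, hy]

theorem conjExt_ιMulti {m : ℕ} (v : Fin m → Covector n) :
    conjExt (ExteriorAlgebra.ιMulti ℂ m v) =
      ExteriorAlgebra.ιMulti ℂ m fun i => conjCovector (v i) := by
  rw [ExteriorAlgebra.ιMulti_apply, ExteriorAlgebra.ιMulti_apply, map_list_prod, List.map_ofFn]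
  congr 2
  funext i
  exact conjExt_oneForm (v i)

theorem topCoeff_ιMulti (v : Fin (n * 2) → Covector n) :
    topCoeff (ExteriorAlgebra.ιMulti ℂ (n * 2) v) =
      (Matrix.of fun i k => v i (realBasis k)).det := by
  rw [topCoeff, ExteriorAlgebra.liftAlternating_apply_ιMulti, Pi.single_eq_same]
  rfl

theorem topCoeff_ιMulti_of_ne {m : ℕ} (hm : m ≠ n * 2) (v : Fin m → Covector n) :
    topCoeff (ExteriorAlgebra.ιMulti ℂ m v) = 0 := by
  rw [topCoeff, ExteriorAlgebra.liftAlternating_apply_ιMulti, Pi.single_eq_of_ne hm]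
  rfl

/-- Wedge products of covectors span. On such a product the top coefficient is the determinant of
the values on a basis of real tangent vectors, and conjugation acts entrywise on that determinant.
-/
theorem topCoeff_conjExt (x : Ext n) : topCoeff (conjExt x) = starRingEnd ℂ (topCoeff x) := by
  have hx : x ∈ Submodule.span ℂ (Set.range fun x : Σ m, (Fin m → Covector n) =>
      ExteriorAlgebra.ιMulti ℂ x.1 x.2) := by
    rw [ExteriorAlgebra.ιMulti_span]; trivial
  induction hx using Submodule.span_induction with
  | mem x hx =>
    obtain ⟨⟨m, v⟩, rfl⟩ := hx
    simp only [conjExt_ιMulti]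
    by_cases hm : m = n * 2
    · subst hm
      rw [topCoeff_ιMulti, topCoeff_ιMulti, RingHom.map_det]
      rfl
    · rw [topCoeff_ιMulti_of_ne hm, topCoeff_ιMulti_of_ne hm, map_zero]
  | zero => simp
  | add x y _ _ hx hy => rw [map_add, map_add, map_add, map_add, hx, hy]
  | smul c x _ hx => rw [conjExt_smul, map_smul, map_smul, hx, smul_eq_mul, smul_eq_mul, map_mul]

theorem conjExt_toExt {m : ℕ} (η : (Fin n → ℂ) [⋀^Fin m]→L[ℝ] ℝ) :
    conjExt (toExt η) = toExt η := by
  rw [toExt, conjExt_smul, map_sum]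
  congr 1
  · simp
  · refine Finset.sum_congr rfl fun k _ => ?_
    rw [conjExt_smul, Complex.conj_ofReal, conjExt_ιMulti]
    simp only [conjCovector_dualBasis]

/-- Complex conjugation of central forms. -/
def conjCentral : CentralForm n →+* CentralForm n :=
  (conjExt.comp (Subalgebra.center ℂ (Ext n)).val.toRingHom).codRestrict _ fun c => by
    rw [Subalgebra.mem_center_iff]
    intro x
    change x * conjExt (c : Ext n) = conjExt (c : Ext n) * x
    rw [← conjExt_conjExt x, ← map_mul, ← map_mul, CentralForm.commute c]

theorem coe_conjCentral (c : CentralForm n) : (conjCentral c : Ext n) = conjExt (c : Ext n) := rfl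

theorem conjCentral_smul (z : ℂ) (c : CentralForm n) :
    conjCentral (z • c) = starRingEnd ℂ z • conjCentral c :=
  Subtype.ext (conjExt_smul z (c : Ext n))

theorem conjCentral_twoForm (a b : Covector n) :
    conjCentral (twoForm a b) = twoForm (conjCovector a) (conjCovector b) := by
  apply Subtype.ext
  change conjExt (oneForm a * oneForm b) = _
  rw [map_mul, conjExt_oneForm, conjExt_oneForm]
  rfl

end Forms

end ZCritical

end

noncomputable section

namespace ZCritical

/-! ## Words in two letters and the symmetrised bracket -/

section Words

/-- The sum of the words in `i` letters `F` and one letter `S`. -/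
def wordSum {R : Type*} [Ring R] (F S : R) (i : ℕ) : R :=
  ∑ x ∈ Finset.HasAntidiagonal.antidiagonal i, F ^ x.1 * S * F ^ x.2

theorem wordSum_succ {R : Type*} [Ring R] (F S : R) (i : ℕ) :
    wordSum F S (i + 1) = wordSum F S i * F + F ^ (i + 1) * S := by
  rw [wordSum, Finset.Nat.antidiagonal_succ', Finset.sum_cons, wordSum, Finset.sum_map,
    Finset.sum_mul, pow_zero, mul_one, add_comm]
  simp [pow_succ, mul_assoc]

/-- The scalar `ε` acts as a dual number: a word containing two letters `ε • S` carries the factor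
`ε² = 0`. -/
theorem add_smul_pow_succ {C R : Type*} [CommRing C] [Ring R] [Algebra C R] {ε : C}
    (hε : ε * ε = 0) (F S : R) (i : ℕ) :
    (F + ε • S) ^ (i + 1) = F ^ (i + 1) + ε • wordSum F S i := by
  induction i with
  | zero => simp [wordSum]
  | succ i ih =>
    rw [pow_succ, ih, wordSum_succ, mul_add, add_mul, add_mul, smul_mul_smul_comm, hε, zero_smul,
      add_zero, ← pow_succ, mul_smul_comm, smul_mul_assoc, smul_add]
    abel

theorem exists_perm_pair {α : Type*} [DecidableEq α] {x y a b : α} (hxy : x ≠ y) (hab : a ≠ b) :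
    ∃ τ : Equiv.Perm α, τ x = a ∧ τ y = b := by
  refine ⟨Equiv.swap (Equiv.swap x a y) b * Equiv.swap x a, ?_, by simp⟩
  have h1 : a ≠ Equiv.swap x a y := by
    intro h
    have := congrArg (Equiv.swap x a) h
    simp at this
    exact hxy this
  rw [Equiv.Perm.mul_apply, Equiv.swap_apply_left, Equiv.swap_apply_of_ne_of_ne h1 hab]

/-- Double counting of `g (σ p) (σ q)` over permutations `σ` and ordered pairs `p ≠ q`. For a fixed
pair the sum over `σ` does not depend on the pair, by translating with a permutation that moves one
pair to another; for a fixed `σ` the pairs are merely relabelled. -/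
theorem sum_perm_pair {M : Type*} [AddCommGroup M] {m : ℕ} {x y : Fin m} (hxy : x ≠ y)
    (g : Fin m → Fin m → M) :
    (m * (m - 1)) • ∑ σ : Equiv.Perm (Fin m), g (σ x) (σ y) =
      m.factorial • ∑ a, ∑ b, if a = b then 0 else g a b := by
  have h1 : ∀ p ∈ (Finset.univ : Finset (Fin m)).offDiag,
      ∑ σ : Equiv.Perm (Fin m), g (σ p.1) (σ p.2) =
        ∑ σ : Equiv.Perm (Fin m), g (σ x) (σ y) := by
    intro p hp
    obtain ⟨τ, h1, h2⟩ := exists_perm_pair hxy (by simpa using hp : p.1 ≠ p.2)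
    rw [← Equiv.sum_comp (Equiv.mulRight τ)
      (fun σ : Equiv.Perm (Fin m) => g (σ x) (σ y))]
    simp [h1, h2]
  have h2 := Finset.sum_congr rfl h1
  rw [Finset.sum_const, Finset.offDiag_card, Finset.card_univ, Fintype.card_fin] at h2
  rw [Nat.mul_sub, mul_one, ← h2, Finset.sum_comm]
  have hoff : (Finset.univ : Finset (Fin m)).offDiag = Finset.univ.filter fun p => p.1 ≠ p.2 := by
    ext p; simp
  have h3 : ∀ σ : Equiv.Perm (Fin m),
      ∑ p ∈ (Finset.univ : Finset (Fin m)).offDiag, g (σ p.1) (σ p.2) =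
        ∑ a, ∑ b, if a = b then 0 else g a b := by
    intro σ
    rw [hoff, Finset.sum_filter, ← Finset.univ_product_univ,
      Finset.sum_product]
    conv_rhs => rw [← Equiv.sum_comp σ]
    refine Finset.sum_congr rfl fun a _ => ?_
    conv_rhs => rw [← Equiv.sum_comp σ]
    refine Finset.sum_congr rfl fun b _ => ?_
    simp [ite_not]
  rw [Finset.sum_congr rfl fun σ _ => h3 σ, Finset.sum_const, Finset.card_univ,
    Fintype.card_perm, Fintype.card_fin]

/-- Subtraction in `Fin (i + 2)` is cyclic, so for each `a` the difference `b - a` takes every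
nonzero value `1, …, i + 1` once. -/
theorem sum_cyclic {M : Type*} [AddCommGroup M] (i : ℕ) (Q : ℕ → M) :
    (∑ a : Fin (i + 2), ∑ b : Fin (i + 2), if a = b then 0 else Q ((b - a).val - 1)) =
      (i + 2) • ∑ k ∈ Finset.range (i + 1), Q k := by
  have h : ∀ a : Fin (i + 2), (∑ b : Fin (i + 2), if a = b then 0 else Q ((b - a).val - 1)) =
      ∑ k ∈ Finset.range (i + 1), Q k := by
    intro a
    rw [← Equiv.sum_comp (Equiv.addRight a), Fin.sum_univ_succ, Finset.sum_range]
    simp [Fin.succ_ne_zero]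
  rw [Finset.sum_congr rfl fun a _ => h a]
  simp

theorem prod_ofFn_two_letters {R : Type*} [Monoid R] {m : ℕ} {a b : Fin m} (hab : a < b)
    (x y z : R) :
    (List.ofFn fun k => if k = a then x else if k = b then y else z).prod =
      z ^ (a : ℕ) * x * z ^ ((b : ℕ) - a - 1) * y * z ^ (m - 1 - b) := by
  have hb := b.2
  have hab' : (a : ℕ) < b := hab
  have h : (List.ofFn fun k => if k = a then x else if k = b then y else z) =
      List.replicate (a : ℕ) z ++ (x :: (List.replicate ((b : ℕ) - a - 1) z ++
        (y :: List.replicate (m - 1 - b) z))) := by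
    apply List.ext_getElem
    · simp; omega
    · intro k h1 h2
      simp only [List.getElem_ofFn, List.getElem_append, List.getElem_cons, List.getElem_replicate,
        List.length_replicate, Fin.ext_iff]
      split_ifs <;> first | rfl | omega
  rw [h]
  simp [mul_assoc]

/-- A pair involving a letter of degree two contributes an even exponent. Only the two final letters
are odd, so the sign records whether their order is reversed. -/
theorem koszul_sign_two_odd {i : ℕ} (σ : Equiv.Perm (Fin (i + 2))) :
    (∏ k : Fin (i + 2), ∏ l : Fin (i + 2),
      if k < l ∧ σ l < σ k then
        (-1 : ℂ) ^ (Fin.append (fun _ : Fin i => 2) ![1, 1] (σ k) *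
          Fin.append (fun _ : Fin i => 2) ![1, 1] (σ l)) else 1) =
      if σ⁻¹ (Fin.natAdd i 1) < σ⁻¹ (Fin.natAdd i 0) then -1 else 1 := by
  have key : ∀ p q : Fin (i + 2), q < p →
      (-1 : ℂ) ^ (Fin.append (fun _ : Fin i => 2) ![1, 1] p *
          Fin.append (fun _ : Fin i => 2) ![1, 1] q) =
        if p = Fin.natAdd i 1 ∧ q = Fin.natAdd i 0 then -1 else 1 := by
    intro p q hpq
    induction p using Fin.addCases with
    | left p =>
      rw [Fin.append_left, if_neg, pow_mul]
      · simp
      · rintro ⟨h, -⟩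
        have := congrArg Fin.val h
        simp at this
        omega
    | right p =>
      induction q using Fin.addCases with
      | left q =>
        rw [Fin.append_left, if_neg, mul_comm, pow_mul]
        · simp
        · rintro ⟨-, h⟩
          have := congrArg Fin.val h
          simp at this
          omega
      | right q =>
        fin_cases p <;> fin_cases q <;> simp_all
  have h : ∀ k l : Fin (i + 2), (if k < l ∧ σ l < σ k then
        (-1 : ℂ) ^ (Fin.append (fun _ : Fin i => 2) ![1, 1] (σ k) *
          Fin.append (fun _ : Fin i => 2) ![1, 1] (σ l)) else 1) =
      if k = σ⁻¹ (Fin.natAdd i 1) then (if l = σ⁻¹ (Fin.natAdd i 0) then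
        (if σ⁻¹ (Fin.natAdd i 1) < σ⁻¹ (Fin.natAdd i 0) then -1 else 1) else 1) else 1 := by
    intro k l
    simp only [Equiv.Perm.eq_inv_iff_eq]
    by_cases hk : σ k = Fin.natAdd i 1
    · by_cases hl : σ l = Fin.natAdd i 0
      · have h1 : σ⁻¹ (Fin.natAdd i 1) = k := by rw [← hk]; simp
        have h2 : σ⁻¹ (Fin.natAdd i 0) = l := by rw [← hl]; simp
        rw [h1, h2]
        simp [hk, hl]
      · rw [if_pos hk, if_neg hl]
        split_ifs with hc
        · rw [key _ _ hc.2, if_neg fun h => hl h.2]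
        · rfl
    · rw [if_neg hk]
      split_ifs with hc
      · rw [key _ _ hc.2, if_neg fun h => hk h.1]
      · rfl
  simp [h]

end Words

/-! ### The trace of the symmetrised bracket of `F, …, F, u, u*`. -/

section Bracket

variable {n r : ℕ}

/-- A matrix of central forms as a matrix of forms. -/
def extMatrix : Matrix (Fin r) (Fin r) (CentralForm n) →+* Matrix (Fin r) (Fin r) (Ext n) :=
  (Subalgebra.center ℂ (Ext n)).val.toRingHom.mapMatrix

theorem trace_extMatrix (A : Matrix (Fin r) (Fin r) (CentralForm n)) :
    (extMatrix A).trace = (A.trace : Ext n) := by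
  simp [extMatrix, Matrix.trace]

theorem extMatrix_mul_smul (A : Matrix (Fin r) (Fin r) (CentralForm n)) (x : Ext n)
    (B : Matrix (Fin r) (Fin r) (Ext n)) : extMatrix A * (x • B) = x • (extMatrix A * B) := by
  ext a b
  simp only [Matrix.mul_apply, Matrix.smul_apply, smul_eq_mul, Finset.mul_sum, ← mul_assoc]
  refine Finset.sum_congr rfl fun c _ => ?_
  congr 1
  exact CentralForm.commute _ _

/-- The covectors can be pulled out to the left in their order because the matrix entries they pass
are central. What remains has commuting entries, so the trace is cyclic and the two outer powers of
`F` merge. -/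
theorem trace_word (F S : Matrix (Fin r) (Fin r) (CentralForm n)) (v w : Covector n) (a c e : ℕ) :
    (extMatrix F ^ a * (oneForm v • extMatrix S) * extMatrix F ^ c * (oneForm w • extMatrix S) *
      extMatrix F ^ e).trace =
      ((twoForm v w * (S * F ^ c * S * F ^ (e + a)).trace : CentralForm n) : Ext n) := by
  rw [← map_pow, ← map_pow, ← map_pow, extMatrix_mul_smul, ← map_mul, smul_mul_assoc, ← map_mul,
    smul_mul_assoc, extMatrix_mul_smul, smul_mul_assoc, smul_mul_assoc, ← map_mul, ← map_mul,
    smul_smul, Matrix.trace_smul, trace_extMatrix, pow_add, ← mul_assoc,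
    Matrix.trace_mul_comm _ (F ^ a)]
  simp only [← mul_assoc]
  rfl

/-- Every permuted word contributes `Q` of the cyclic gap from the `v`-letter to the `w`-letter.
Averaging over permutations makes all `i + 1` gaps equally frequent, which is the source of the
factor `1 / (i + 1)`. -/
theorem symBracket_trace (F S : Matrix (Fin r) (Fin r) (CentralForm n)) (v w : Covector n)
    (i : ℕ) :
    (symBracket (Fin.append (fun _ : Fin i => 2) ![1, 1])
      (Fin.append (fun _ : Fin i => extMatrix F)
        ![oneForm v • extMatrix S, oneForm w • extMatrix S])).trace =
      ((((i : ℂ) + 1)⁻¹ • (twoForm v w * (wordSum F S i * S).trace) : CentralForm n) : Ext n) := by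
  set Q : ℕ → CentralForm n := fun k => twoForm v w * (S * F ^ k * S * F ^ (i - k)).trace with hQ
  -- Rotating the cyclic word by one letter `S` interchanges the two gaps.
  have hQsymm : ∀ k, k ≤ i → Q (i - k) = Q k := by
    intro k hk
    simp only [hQ]
    rw [mul_assoc (S * _), Matrix.trace_mul_comm, Nat.sub_sub_self hk, mul_assoc (S * _)]
  have hsum : twoForm v w * (wordSum F S i * S).trace = ∑ k ∈ Finset.range (i + 1), Q k := by
    rw [wordSum, Finset.sum_mul, Matrix.trace_sum, Finset.mul_sum,
      Finset.Nat.sum_antidiagonal_eq_sum_range_succ_mk]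
    refine Finset.sum_congr rfl fun k _ => ?_
    simp only [hQ]
    rw [Matrix.trace_mul_comm _ S]
    simp only [mul_assoc]
  have hword : ∀ σ : Equiv.Perm (Fin (i + 2)),
      ((∏ k : Fin (i + 2), ∏ l : Fin (i + 2),
        if k < l ∧ σ l < σ k then
          (-1 : ℂ) ^ (Fin.append (fun _ : Fin i => 2) ![1, 1] (σ k) *
            Fin.append (fun _ : Fin i => 2) ![1, 1] (σ l)) else 1) •
        (List.ofFn fun k => Fin.append (fun _ : Fin i => extMatrix F)
          ![oneForm v • extMatrix S, oneForm w • extMatrix S] (σ k)).prod).trace =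
      ((Q ((σ⁻¹ (Fin.natAdd i 1) - σ⁻¹ (Fin.natAdd i 0)).val - 1) : CentralForm n) : Ext n) := by
    intro σ
    rw [koszul_sign_two_odd]
    set a := σ⁻¹ (Fin.natAdd i 0) with ha
    set b := σ⁻¹ (Fin.natAdd i 1) with hb
    have hab : a ≠ b := by
      rw [ha, hb, Ne, σ⁻¹.injective.eq_iff]
      simp
    have hB : ∀ k, Fin.append (fun _ : Fin i => extMatrix F)
          ![oneForm v • extMatrix S, oneForm w • extMatrix S] (σ k) =
        if k = a then oneForm v • extMatrix S else
          if k = b then oneForm w • extMatrix S else extMatrix F := by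
      intro k
      simp only [ha, hb, Equiv.Perm.eq_inv_iff_eq]
      generalize σ k = q
      induction q using Fin.addCases with
      | left q =>
        rw [Fin.append_left, if_neg, if_neg]
        · exact fun h => by have := congrArg Fin.val h; simp at this; omega
        · exact fun h => by have := congrArg Fin.val h; simp at this; omega
      | right q => fin_cases q <;> simp
    simp only [hB]
    have hal := a.2
    have hbl := b.2
    rcases lt_or_gt_of_ne hab with h | h
    · have h' : (a : ℕ) < b := h
      rw [if_neg (not_lt.2 h.le), one_smul, prod_ofFn_two_letters h, trace_word,
        Fin.sub_val_of_le h.le]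
      congr 6
      omega
    · have h' : (b : ℕ) < a := h
      have hswap : ∀ k, (if k = a then oneForm v • extMatrix S else
          if k = b then oneForm w • extMatrix S else extMatrix F) =
          if k = b then oneForm w • extMatrix S else
          if k = a then oneForm v • extMatrix S else extMatrix F := by
        intro k
        split_ifs with h1 h2 <;> first | rfl | exact absurd (h1.symm.trans h2) hab
      simp only [hswap]
      -- The `w`-letter comes first, so the cyclic gap from `a` to `b` wraps around and is
      -- complementary to the linear gap `a - b - 1`. The symmetry of `Q` identifies the two, and
      -- the Koszul sign cancels `w ∧ v = -(v ∧ w)`.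
      have hval : (b - a).val - 1 = i - ((a : ℕ) - b - 1) := by
        rw [Fin.coe_sub_iff_lt.2 h]
        omega
      have hneg : ∀ c : CentralForm n, twoForm w v * c = -(twoForm v w * c) := by
        intro c
        rw [twoForm_swap w v]
        exact neg_mul _ _
      rw [if_pos h, prod_ofFn_two_letters h, Matrix.trace_smul, trace_word, hneg, hval,
        hQsymm _ (by omega)]
      simp only [hQ]
      rw [show i + 2 - 1 - (a : ℕ) + b = i - ((a : ℕ) - b - 1) by omega, neg_one_smul,
        neg_eq_iff_eq_neg]
      rfl
  have hperm := sum_perm_pair (x := Fin.natAdd i 0) (y := Fin.natAdd i 1) (by simp)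
    fun a b : Fin (i + 2) => Q ((b - a).val - 1)
  rw [sum_cyclic, ← hsum, ← Equiv.sum_comp (Equiv.inv (Equiv.Perm (Fin (i + 2))))] at hperm
  simp only [Equiv.inv_apply, ← Nat.cast_smul_eq_nsmul ℂ] at hperm
  rw [symBracket, Matrix.trace_smul, Matrix.trace_sum, Finset.sum_congr rfl fun σ _ => hword σ,
    ← AddSubmonoidClass.coe_finsetSum]
  change (((_ : ℂ) • _ : CentralForm n) : Ext n) = _
  congr 1
  have hi : (i : ℂ) + 1 ≠ 0 := by exact_mod_cast Nat.succ_ne_zero i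
  have hi2 : (i : ℂ) + 2 ≠ 0 := by exact_mod_cast Nat.succ_ne_zero (i + 1)
  have hf : ((i + 2).factorial : ℂ) ≠ 0 := by exact_mod_cast (i + 2).factorial_ne_zero
  rw [inv_smul_eq_iff₀ hf, smul_smul]
  -- Dividing the double count by the number `(i + 2)(i + 1)` of ordered pairs leaves `(i + 2)! / (i
  -- + 1)` times the sum of the `Q k`.
  have := congrArg (fun z => (((i : ℂ) + 2) * (i + 1))⁻¹ • z) hperm
  simp only [smul_smul] at this
  convert this using 1
  · rw [show ((i + 2) * (i + 2 - 1) : ℕ) = (i + 2) * (i + 1) from rfl]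
    push_cast
    rw [inv_mul_cancel₀ (mul_ne_zero hi2 hi), one_smul]
  · congr 1
    push_cast
    field_simp

end Bracket

end ZCritical

end

noncomputable section

namespace ZCritical

/-! ## The top power of a positive form of type `(1,1)` -/

section Kahler

/-- Induction on the set, with the new element as the dual number of `add_smul_pow_succ`. The higher
power of the old sum vanishes since each of its terms repeats a factor, and the words with one
letter `1` are all equal. -/
theorem sum_pow_card_of_sq_zero {ι C : Type*} [CommRing C] [DecidableEq ι] (s : Finset ι)
    (x : ι → C) (hx : ∀ i, x i * x i = 0) :
    (∑ i ∈ s, x i) ^ s.card = s.card.factorial • ∏ i ∈ s, x i := by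
  induction s using Finset.induction with
  | empty => simp
  | insert a s ha ih =>
    have h0 : (∑ i ∈ s, x i) ^ (s.card + 1) = 0 := by
      rw [pow_succ, ih, Finset.mul_sum]
      refine Finset.sum_eq_zero fun i hi => ?_
      rw [← Finset.mul_prod_erase s x hi, smul_mul_assoc, mul_right_comm, hx, zero_mul, smul_zero]
    have hw : wordSum (∑ i ∈ s, x i) 1 s.card = (s.card + 1) • (∑ i ∈ s, x i) ^ s.card := by
      rw [wordSum, Finset.sum_congr rfl (g := fun _ => (∑ i ∈ s, x i) ^ s.card), Finset.sum_const,
        Finset.Nat.card_antidiagonal]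
      intro p hp
      rw [mul_one, ← pow_add, Finset.HasAntidiagonal.mem_antidiagonal.1 hp]
    have h := add_smul_pow_succ (hx a) (∑ i ∈ s, x i) 1 s.card
    rw [smul_eq_mul, mul_one, h0, zero_add, hw, ih] at h
    rw [Finset.sum_insert ha, Finset.card_insert_of_notMem ha, add_comm, h,
      Finset.prod_insert ha, Nat.factorial_succ, smul_smul, smul_eq_mul, mul_smul_comm]

variable {n : ℕ}

theorem eq_sum_realBasis (v : Fin n → ℂ) :
    v = ∑ k : Fin (n * 2), (dualBasis k v).re • realBasis k := by
  rw [← Equiv.sum_comp finProdFinEquiv, Fintype.sum_prod_type]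
  ext j
  simp only [Fin.sum_univ_two, Finset.sum_apply, Pi.add_apply, Pi.smul_apply, dualBasis,
    realBasis, LinearMap.coe_mk, AddHom.coe_mk, Equiv.symm_apply_apply, Complex.ofReal_re]
  simp only [Pi.single_apply]
  apply Complex.ext
  · simp [Finset.sum_add_distrib]
  · simp [Finset.sum_add_distrib]

theorem dualBasis_realBasis (k l : Fin (n * 2)) :
    dualBasis k (realBasis l) = if k = l then 1 else 0 := by
  obtain ⟨⟨i, a⟩, rfl⟩ := finProdFinEquiv.surjective k
  obtain ⟨⟨j, b⟩, rfl⟩ := finProdFinEquiv.surjective l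
  simp only [finProdFinEquiv.injective.eq_iff, Prod.mk.injEq, dualBasis, realBasis,
    LinearMap.coe_mk, AddHom.coe_mk, Equiv.symm_apply_apply, Pi.single_apply]
  fin_cases a <;> fin_cases b <;> by_cases h : i = j <;> simp [h]

theorem covector_eq_sum (w : Covector n) :
    w = ∑ k : Fin (n * 2), w (realBasis k) • dualBasis k := by
  apply LinearMap.ext
  intro v
  conv_lhs => rw [eq_sum_realBasis v, map_sum]
  rw [LinearMap.sum_apply]
  refine Finset.sum_congr rfl fun k _ => ?_
  rw [map_smul, LinearMap.smul_apply, smul_eq_mul, mul_comm, Complex.real_smul]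
  rfl

theorem oneForm_eq_sum (w : Covector n) :
    oneForm w = ∑ k : Fin (n * 2), w (realBasis k) • oneForm (dualBasis k) := by
  conv_lhs => rw [covector_eq_sum w]
  simp [oneForm]

/-- The double sum over basis indices yields both `α ∧ β` and `-(β ∧ α)`, which agree, so the
normalisation `1/2!` cancels. -/
theorem toExt_two_form (κ : (Fin n → ℂ) [⋀^Fin 2]→L[ℝ] ℝ) (α β : Fin n → Covector n)
    (hκ : ∀ v w, ((κ ![v, w] : ℝ) : ℂ) = ∑ j, (α j v * β j w - β j v * α j w)) :
    toExt κ = ((∑ j, twoForm (α j) (β j) : CentralForm n) : Ext n) := by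
  have h1 : ∑ k : Fin 2 → Fin (n * 2), ((κ fun i => realBasis (k i) : ℝ) : ℂ) •
      ExteriorAlgebra.ιMulti ℂ 2 (fun i => dualBasis (k i)) =
      ∑ k : Fin (n * 2), ∑ l : Fin (n * 2), ((κ ![realBasis k, realBasis l] : ℝ) : ℂ) •
        (oneForm (dualBasis k) * oneForm (dualBasis l)) := by
    rw [← Equiv.sum_comp (finTwoArrowEquiv (Fin (n * 2))).symm, Fintype.sum_prod_type]
    refine Finset.sum_congr rfl fun k _ => Finset.sum_congr rfl fun l _ => ?_
    congr 2
    · congr 2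
      ext i; fin_cases i <;> rfl
    · rw [ExteriorAlgebra.ιMulti_apply]
      simp only [List.ofFn_succ, List.ofFn_zero, List.prod_cons, List.prod_nil, mul_one]
      rfl
  have h2 : ∀ v w : Covector n, oneForm v * oneForm w = ∑ k : Fin (n * 2), ∑ l : Fin (n * 2),
      (v (realBasis k) * w (realBasis l)) • (oneForm (dualBasis k) * oneForm (dualBasis l)) := by
    intro v w
    conv_lhs => rw [oneForm_eq_sum v, oneForm_eq_sum w, Finset.sum_mul_sum]
    simp only [smul_mul_smul_comm]
  have h3 : ∑ k : Fin (n * 2), ∑ l : Fin (n * 2), ((κ ![realBasis k, realBasis l] : ℝ) : ℂ) •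
        (oneForm (dualBasis k) * oneForm (dualBasis l)) =
      ∑ j, (oneForm (α j) * oneForm (β j) - oneForm (β j) * oneForm (α j)) := by
    simp only [hκ, Finset.sum_smul, sub_smul]
    rw [Finset.sum_congr rfl fun k _ => Finset.sum_comm, Finset.sum_comm]
    refine Finset.sum_congr rfl fun j _ => ?_
    rw [h2 (α j), h2 (β j)]
    simp only [Finset.sum_sub_distrib]
  rw [toExt, h1, h3, Finset.smul_sum, AddSubmonoidClass.coe_finsetSum]
  refine Finset.sum_congr rfl fun j _ => ?_
  rw [oneForm_mul_swap (β j), sub_neg_eq_add, ← two_smul ℂ, smul_smul]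
  simp [twoForm]

theorem coe_prod_twoForm (α β : Fin n → Covector n) :
    ((∏ j, twoForm (α j) (β j) : CentralForm n) : Ext n) =
      ExteriorAlgebra.ιMulti ℂ (n * 2) fun k =>
        if (finProdFinEquiv.symm k).2 = 0 then α (finProdFinEquiv.symm k).1
        else β (finProdFinEquiv.symm k).1 := by
  rw [ExteriorAlgebra.ιMulti_apply, List.ofFn_mul, List.prod_flatten, List.map_ofFn,
    ← List.prod_ofFn]
  change (Subalgebra.center ℂ (Ext n)).val _ = _
  rw [map_list_prod, List.map_ofFn]
  congr 2
  funext j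
  have h : ∀ i : Fin 2, ∀ hi, (⟨j * 2 + i, hi⟩ : Fin (n * 2)) = finProdFinEquiv (j, i) := by
    intro i hi
    ext
    simp [finProdFinEquiv]
    ring
  simp only [Function.comp_apply, h, Equiv.symm_apply_apply]
  simp [twoForm, oneForm]

/-- The coefficient is a `2n × 2n` determinant. A kernel vector would be a nonzero tangent vector
annihilated by all the covectors. -/
theorem topCoeff_prod_ne_zero (α β : Fin n → Covector n)
    (hα : ∀ j v, starRingEnd ℂ (α j v) = α j v) (hβ : ∀ j v, starRingEnd ℂ (β j v) = β j v)
    (hinj : ∀ v, (∀ j, α j v = 0) → (∀ j, β j v = 0) → v = 0) :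
    topCoeff ((∏ j, twoForm (α j) (β j) : CentralForm n) : Ext n) ≠ 0 := by
  rw [coe_prod_twoForm, topCoeff_ιMulti]
  set γ : Fin (n * 2) → Covector n := fun k =>
    if (finProdFinEquiv.symm k).2 = 0 then α (finProdFinEquiv.symm k).1
        else β (finProdFinEquiv.symm k).1 with hγ
  have hreal : ∀ k v, (((γ k v).re : ℝ) : ℂ) = γ k v := by
    intro k v
    rw [← Complex.conj_eq_iff_re]
    simp only [hγ]
    split_ifs
    exacts [hα _ _, hβ _ _]
  -- Reality of the covectors is needed here: only a kernel vector with real coordinates represents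
  -- a tangent vector.
  have hM : (Matrix.of fun i k => γ i (realBasis k)) =
      (Matrix.of fun i k => (γ i (realBasis k)).re).map Complex.ofRealHom := by
    ext i k
    exact (hreal _ _).symm
  rw [hM, ← RingHom.mapMatrix_apply, ← RingHom.map_det]
  intro h0
  rw [map_eq_zero, ← Matrix.exists_mulVec_eq_zero_iff] at h0
  obtain ⟨x, hx, h0⟩ := h0
  have hv : ∀ k, γ k (∑ l, x l • realBasis l) = 0 := by
    intro k
    have := congrArg Complex.ofReal (congrFun h0 k)
    rw [map_sum]
    simp only [Matrix.mulVec, dotProduct, Matrix.of_apply, Pi.zero_apply, Complex.ofReal_sum,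
      Complex.ofReal_mul, hreal, Complex.ofReal_zero] at this
    rw [← this]
    refine Finset.sum_congr rfl fun l _ => ?_
    rw [map_smul, Complex.real_smul, mul_comm]
  have hv0 := hinj (∑ l, x l • realBasis l)
    (fun j => by
      have := hv (finProdFinEquiv (j, 0))
      simp only [hγ, Equiv.symm_apply_apply] at this
      simpa only [if_true] using this)
    (fun j => by
      have := hv (finProdFinEquiv (j, 1))
      simp only [hγ, Equiv.symm_apply_apply] at this
      simpa only [Fin.one_eq_zero_iff, OfNat.ofNat_ne_one, one_ne_zero, if_false] using this)
  apply hx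
  ext k
  have := congrArg (dualBasis k) hv0
  simpa [dualBasis_realBasis] using this

theorem map_vec_two_add (κ : (Fin n → ℂ) [⋀^Fin 2]→L[ℝ] ℝ) (v v' w : Fin n → ℂ) :
    κ ![v + v', w] = κ ![v, w] + κ ![v', w] :=
  κ.toAlternatingMap.map_vecCons_add ![w] v v'

theorem map_vec_two_smul (κ : (Fin n → ℂ) [⋀^Fin 2]→L[ℝ] ℝ) (c : ℝ) (v w : Fin n → ℂ) :
    κ ![c • v, w] = c * κ ![v, w] :=
  κ.toAlternatingMap.map_vecCons_smul ![w] c v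

theorem map_vec_two_swap (κ : (Fin n → ℂ) [⋀^Fin 2]→L[ℝ] ℝ) (v w : Fin n → ℂ) :
    κ ![v, w] = -κ ![w, v] := by
  have := κ.toAlternatingMap.map_swap ![w, v] (i := 0) (j := 1) (by simp)
  rw [← show (![w, v] ∘ Equiv.swap 0 1 : Fin 2 → Fin n → ℂ) = ![v, w] by
    ext i; fin_cases i <;> simp]
  exact this

theorem map_vec_two_add_right (κ : (Fin n → ℂ) [⋀^Fin 2]→L[ℝ] ℝ) (v w w' : Fin n → ℂ) :
    κ ![v, w + w'] = κ ![v, w] + κ ![v, w'] := by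
  rw [map_vec_two_swap, map_vec_two_add, map_vec_two_swap κ v, map_vec_two_swap κ v]
  ring

theorem map_vec_two_smul_right (κ : (Fin n → ℂ) [⋀^Fin 2]→L[ℝ] ℝ) (c : ℝ) (v w : Fin n → ℂ) :
    κ ![v, c • w] = c * κ ![v, w] := by
  rw [map_vec_two_swap, map_vec_two_smul, map_vec_two_swap κ v]
  ring

theorem complex_smul_eq (c : ℂ) (v : Fin n → ℂ) :
    c • v = c.re • v + c.im • (Complex.I • v) := by
  ext j
  simp only [Pi.smul_apply, Pi.add_apply, Complex.real_smul, smul_eq_mul]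
  conv_lhs => rw [← Complex.re_add_im c]
  ring

theorem map_vec_two_I_left {κ : (Fin n → ℂ) [⋀^Fin 2]→L[ℝ] ℝ}
    (h11 : ∀ v w, κ ![Complex.I • v, Complex.I • w] = κ ![v, w]) (v w : Fin n → ℂ) :
    κ ![Complex.I • v, w] = -κ ![v, Complex.I • w] := by
  rw [← h11 v (Complex.I • w), smul_smul, Complex.I_mul_I,
    show ((-1 : ℂ) • w) = (-1 : ℝ) • w by simp, map_vec_two_smul_right]
  ring

theorem map_vec_two_I_right {κ : (Fin n → ℂ) [⋀^Fin 2]→L[ℝ] ℝ} (v w : Fin n → ℂ) :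
    κ ![v, Complex.I • (Complex.I • w)] = -κ ![v, w] := by
  rw [smul_smul, Complex.I_mul_I, show ((-1 : ℂ) • w) = (-1 : ℝ) • w by simp,
    map_vec_two_smul_right]
  ring

/-- The Hermitian form, conjugate-linear in the first variable, whose imaginary part is a given
real form of type `(1,1)`. -/
def hermOfForm (κ : (Fin n → ℂ) [⋀^Fin 2]→L[ℝ] ℝ)
    (h11 : ∀ v w, κ ![Complex.I • v, Complex.I • w] = κ ![v, w]) :
    (Fin n → ℂ) →ₗ⋆[ℂ] (Fin n → ℂ) →ₗ[ℂ] ℂ :=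
  LinearMap.mk₂'ₛₗ (starRingEnd ℂ) (RingHom.id ℂ)
    (fun v w => (κ ![v, Complex.I • w] : ℂ) + Complex.I * (κ ![v, w] : ℂ))
    (fun v v' w => by
      simp only [map_vec_two_add, Complex.ofReal_add]; ring)
    (fun c v w => by
      rw [complex_smul_eq c v]
      simp only [map_vec_two_add, map_vec_two_smul, h11, map_vec_two_I_left h11 v w]
      apply Complex.ext <;> simp)
    (fun v w w' => by
      simp only [smul_add, map_vec_two_add_right, Complex.ofReal_add]; ring)
    (fun c v w => by
      rw [complex_smul_eq c w]
      simp only [smul_add, smul_comm Complex.I (_ : ℝ), map_vec_two_add_right,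
        map_vec_two_smul_right, map_vec_two_I_right]
      apply Complex.ext
      · simp
      · simp
        ring)

theorem hermOfForm_apply (κ : (Fin n → ℂ) [⋀^Fin 2]→L[ℝ] ℝ)
    (h11 : ∀ v w, κ ![Complex.I • v, Complex.I • w] = κ ![v, w]) (v w : Fin n → ℂ) :
    hermOfForm κ h11 v w = (κ ![v, Complex.I • w] : ℂ) + Complex.I * (κ ![v, w] : ℂ) := rfl

theorem hermOfForm_self (κ : (Fin n → ℂ) [⋀^Fin 2]→L[ℝ] ℝ)
    (h11 : ∀ v w, κ ![Complex.I • v, Complex.I • w] = κ ![v, w]) (v : Fin n → ℂ) :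
    hermOfForm κ h11 v v = (κ ![v, Complex.I • v] : ℂ) := by
  have : κ ![v, v] = 0 := by linarith [map_vec_two_swap κ v v]
  rw [hermOfForm_apply, this]
  simp

theorem hermOfForm_conj (κ : (Fin n → ℂ) [⋀^Fin 2]→L[ℝ] ℝ)
    (h11 : ∀ v w, κ ![Complex.I • v, Complex.I • w] = κ ![v, w]) (v w : Fin n → ℂ) :
    starRingEnd ℂ (hermOfForm κ h11 v w) = hermOfForm κ h11 w v := by
  rw [hermOfForm_apply, hermOfForm_apply, map_vec_two_swap κ w, map_vec_two_swap κ w,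
    map_vec_two_I_left h11]
  simp

open scoped MatrixOrder ComplexOrder in
/-- A positive real form of type `(1,1)` is a sum of squares `∑ Re (B v)_j ∧ Im (B v)_j`. -/
theorem exists_hermOfForm_eq (κ : (Fin n → ℂ) [⋀^Fin 2]→L[ℝ] ℝ)
    (h11 : ∀ v w, κ ![Complex.I • v, Complex.I • w] = κ ![v, w])
    (hpos : ∀ v, v ≠ 0 → 0 < κ ![v, Complex.I • v]) :
    ∃ B : Matrix (Fin n) (Fin n) ℂ, ∀ v w,
      hermOfForm κ h11 v w = star (B *ᵥ v) ⬝ᵥ (B *ᵥ w) := by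
  set P : Matrix (Fin n) (Fin n) ℂ :=
    Matrix.of fun i j => hermOfForm κ h11 (Pi.single i 1) (Pi.single j 1) with hP
  have hPvw : ∀ v w, hermOfForm κ h11 v w = star v ⬝ᵥ (P *ᵥ w) := by
    intro v w
    conv_lhs => rw [pi_eq_sum_univ' v, pi_eq_sum_univ' w]
    simp only [map_sum, LinearMap.sum_apply, map_smulₛₗ, LinearMap.smul_apply, smul_eq_mul,
      dotProduct, Matrix.mulVec, Finset.mul_sum]
    rw [Finset.sum_comm]
    refine Finset.sum_congr rfl fun i _ => Finset.sum_congr rfl fun j _ => ?_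
    simp [hP]
    ring
  have hherm : P.IsHermitian := by
    ext i j
    exact hermOfForm_conj κ h11 _ _
  have hpd : P.PosSemidef := by
    refine Matrix.PosSemidef.of_dotProduct_mulVec_nonneg hherm fun v => ?_
    rw [← hPvw, hermOfForm_self]
    by_cases hv : v = 0
    · subst hv
      rw [← hermOfForm_self κ h11, map_zero]
    · exact_mod_cast (hpos v hv).le
  obtain ⟨B, hB⟩ := CStarAlgebra.nonneg_iff_eq_star_mul_self.mp hpd.nonneg
  refine ⟨B, fun v w => ?_⟩
  rw [hPvw, hB, Matrix.star_eq_conjTranspose, Matrix.star_mulVec, ← Matrix.dotProduct_mulVec,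
    Matrix.mulVec_mulVec]

/-- The real part of a complex-linear form as a covector. -/
def reCovector (f : (Fin n → ℂ) →ₗ[ℂ] ℂ) : Covector n where
  toFun v := ((f v).re : ℂ)
  map_add' v w := by simp
  map_smul' c v := by
    rw [← algebraMap_smul ℂ c v, map_smul]
    simp

/-- The imaginary part of a complex-linear form as a covector. -/
def imCovector (f : (Fin n → ℂ) →ₗ[ℂ] ℂ) : Covector n where
  toFun v := ((f v).im : ℂ)
  map_add' v w := by simp
  map_smul' c v := by
    rw [← algebraMap_smul ℂ c v, map_smul]
    simp

/-- In the linear forms `f j` given by the rows of `B`, the form is `∑ Re f_j ∧ Im f_j`, so its top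
power is `n!` times the product of these planes. A vector killed by all of them lies in the kernel
of `B`, which strict positivity excludes. -/
theorem topCoeff_pow_ne_zero (κ : (Fin n → ℂ) [⋀^Fin 2]→L[ℝ] ℝ)
    (h11 : ∀ v w, κ ![Complex.I • v, Complex.I • w] = κ ![v, w])
    (hpos : ∀ v, v ≠ 0 → 0 < κ ![v, Complex.I • v]) : topCoeff (toExt κ ^ n) ≠ 0 := by
  obtain ⟨B, hB⟩ := exists_hermOfForm_eq κ h11 hpos
  set f : Fin n → (Fin n → ℂ) →ₗ[ℂ] ℂ := fun j => LinearMap.proj j ∘ₗ B.mulVecLin with hf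
  have hf' : ∀ j v, f j v = (B *ᵥ v) j := fun j v => rfl
  have hκ := toExt_two_form κ (fun j => reCovector (f j)) (fun j => imCovector (f j)) (by
    intro v w
    have h := congrArg Complex.im (hB v w)
    rw [hermOfForm_apply] at h
    simp only [Complex.add_im, Complex.ofReal_im, Complex.mul_im, Complex.I_re, Complex.I_im,
      Complex.ofReal_re, dotProduct, Complex.im_sum, Pi.star_apply, ← hf', Complex.star_def,
      Complex.conj_re, Complex.conj_im] at h
    simp only [reCovector, imCovector, LinearMap.coe_mk, AddHom.coe_mk]
    rw [show κ ![v, w] = ∑ j, ((f j v).re * (f j w).im - (f j v).im * (f j w).re) by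
      simpa [sub_eq_add_neg] using h]
    push_cast
    rfl)
  rw [hκ, ← SubmonoidClass.coe_pow]
  have := sum_pow_card_of_sq_zero Finset.univ
    (fun j => twoForm (reCovector (f j)) (imCovector (f j))) fun j => twoForm_mul_self _ _
  rw [Finset.card_univ, Fintype.card_fin] at this
  rw [this, ← Nat.cast_smul_eq_nsmul ℂ]
  change topCoeff ((n.factorial : ℂ) • ((_ : CentralForm n) : Ext n)) ≠ 0
  rw [map_smul]
  refine smul_ne_zero (by exact_mod_cast n.factorial_ne_zero)
    (topCoeff_prod_ne_zero _ _ (fun j v => Complex.conj_ofReal _) (fun j v => Complex.conj_ofReal _)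
      fun v h1 h2 => ?_)
  by_contra hv
  have h3 : B *ᵥ v = 0 := by
    ext j
    apply Complex.ext
    · exact Complex.ofReal_eq_zero.1 (h1 j)
    · exact Complex.ofReal_eq_zero.1 (h2 j)
  have h4 := hB v v
  rw [hermOfForm_self, h3, dotProduct_zero] at h4
  have h5 := hpos v hv
  exact h5.ne' (Complex.ofReal_eq_zero.1 h4)

end Kahler

end ZCritical

end

noncomputable section

namespace ZCritical

/-! ## Wirtinger derivatives -/

section Wirtinger

variable {n r : ℕ}

/-- The first-order operator `(∂/∂x_j + c ∂/∂y_j) / 2`; it is `∂/∂z_j` for `c = -i` and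
`∂/∂\bar z_j` for `c = i`. -/
def wirtinger (c : ℂ) (j : Fin n) (g : (Fin n → ℂ) → ℂ) (z : Fin n → ℂ) : ℂ :=
  (1 / 2) * (fderiv ℝ g z (Pi.single j 1) + c * fderiv ℝ g z (Pi.single j Complex.I))

theorem wirt_eq_wirtinger (j : Fin n) (g : (Fin n → ℂ) → ℂ) :
    wirt j g = wirtinger (-Complex.I) j g := by
  funext z
  rw [wirt, wirtinger]
  ring

variable {c c' : ℂ} {j k : Fin n} {f g : (Fin n → ℂ) → ℂ} {z : Fin n → ℂ}

open Filter Topology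

theorem wirtinger_congr (h : f =ᶠ[𝓝 z] g) : wirtinger c j f =ᶠ[𝓝 z] wirtinger c j g :=
  h.fderiv.mono fun y hy => by rw [wirtinger, wirtinger, hy]

theorem wirtinger_add (hf : DifferentiableAt ℝ f z) (hg : DifferentiableAt ℝ g z) :
    wirtinger c j (fun y => f y + g y) z = wirtinger c j f z + wirtinger c j g z := by
  simp only [wirtinger, fderiv_fun_add hf hg, add_apply]
  ring

theorem wirtinger_mul (hf : DifferentiableAt ℝ f z) (hg : DifferentiableAt ℝ g z) :
    wirtinger c j (fun y => f y * g y) z = wirtinger c j f z * g z + f z * wirtinger c j g z := by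
  simp only [wirtinger, fderiv_fun_mul hf hg, add_apply,
    smul_apply, smul_eq_mul]
  ring

theorem wirtinger_const (a : ℂ) : wirtinger c j (fun _ => a) z = 0 := by
  simp [wirtinger]

theorem wirtinger_sum {ι : Type*} (s : Finset ι) {F : ι → (Fin n → ℂ) → ℂ}
    (hF : ∀ i ∈ s, DifferentiableAt ℝ (F i) z) :
    wirtinger c j (fun y => ∑ i ∈ s, F i y) z = ∑ i ∈ s, wirtinger c j (F i) z := by
  simp only [wirtinger, fderiv_fun_sum hF, sum_apply, Finset.mul_sum,
    ← Finset.sum_add_distrib]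

theorem differentiableAt_fderiv_apply (hf : ContDiffAt ℝ 2 f z) (v : Fin n → ℂ) :
    DifferentiableAt ℝ (fun y => fderiv ℝ f y v) z :=
  ((hf.fderiv_right (m := 1) (by norm_num)).differentiableAt one_ne_zero).clm_apply
    (differentiableAt_const v)

theorem ContDiffAt.differentiableAt_wirtinger (hf : ContDiffAt ℝ 2 f z) :
    DifferentiableAt ℝ (wirtinger c j f) z :=
  ((differentiableAt_fderiv_apply hf _).add
    ((differentiableAt_fderiv_apply hf _).const_mul c)).const_mul (1 / 2)

theorem wirtinger_comm (hf : ContDiffAt ℝ 2 f z) :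
    wirtinger c j (wirtinger c' k f) z = wirtinger c' k (wirtinger c j f) z := by
  have hd : DifferentiableAt ℝ (fderiv ℝ f) z :=
    (hf.fderiv_right (m := 1) (by norm_num)).differentiableAt one_ne_zero
  have hsymm : IsSymmSndFDerivAt ℝ f z := hf.isSymmSndFDerivAt (by simp)
  have key : ∀ (c : ℂ) (j : Fin n) (v : Fin n → ℂ), fderiv ℝ (wirtinger c j f) z v =
      (1 / 2) * (fderiv ℝ (fderiv ℝ f) z v (Pi.single j 1) +
        c * fderiv ℝ (fderiv ℝ f) z v (Pi.single j Complex.I)) := by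
    intro c j v
    have h1 : ∀ u : Fin n → ℂ, HasFDerivAt (fun y => fderiv ℝ f y u)
        ((fderiv ℝ (fderiv ℝ f) z).flip u) z := fun u => by
      simpa using hd.hasFDerivAt.clm_apply (hasFDerivAt_const u z)
    have h2 : HasFDerivAt (wirtinger c j f) _ z :=
      ((h1 (Pi.single j 1)).add ((h1 (Pi.single j Complex.I)).const_mul c)).const_mul (1 / 2 : ℂ)
    rw [h2.fderiv]
    rfl
  rw [wirtinger, wirtinger, key, key, key, key, hsymm (Pi.single k 1), hsymm (Pi.single k 1),
    hsymm (Pi.single k Complex.I), hsymm (Pi.single k Complex.I)]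
  ring

theorem wirtinger_conj (hf : DifferentiableAt ℝ f z) :
    wirtinger c j (fun y => starRingEnd ℂ (f y)) z =
      starRingEnd ℂ (wirtinger (starRingEnd ℂ c) j f z) := by
  have h : HasFDerivAt (fun y => starRingEnd ℂ (f y))
      ((Complex.conjCLE : ℂ →L[ℝ] ℂ).comp (fderiv ℝ f z)) z :=
    (Complex.conjCLE : ℂ →L[ℝ] ℂ).hasFDerivAt.comp z hf.hasFDerivAt
  rw [wirtinger, wirtinger, h.fderiv]
  simp only [map_mul, map_add, Complex.conj_conj, map_div₀, map_one, map_ofNat]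
  rfl

/-- Mixed second derivatives of `f² g` at a zero of `f`. -/
theorem wirtinger_wirtinger_sq_mul (hf : ContDiffAt ℝ 2 f z) (hg : ContDiffAt ℝ 2 g z)
    (h0 : f z = 0) :
    wirtinger c j (wirtinger c' k fun y => f y ^ 2 * g y) z =
      2 * wirtinger c j f z * wirtinger c' k f z * g z := by
  have hf' : ∀ᶠ y in 𝓝 z, DifferentiableAt ℝ f y :=
    (hf.eventually (by simp)).mono fun y hy => hy.differentiableAt two_ne_zero
  have hg' : ∀ᶠ y in 𝓝 z, DifferentiableAt ℝ g y :=
    (hg.eventually (by simp)).mono fun y hy => hy.differentiableAt two_ne_zero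
  -- One factor `f` survives the first derivative, so at the zero of `f` the second derivative must
  -- fall on it.
  have h1 : (wirtinger c' k fun y => f y ^ 2 * g y) =ᶠ[𝓝 z]
      fun y => f y * (2 * wirtinger c' k f y * g y + f y * wirtinger c' k g y) := by
    filter_upwards [hf', hg'] with y h1 h2
    simp only [pow_two]
    rw [wirtinger_mul (h1.fun_mul h1) h2, wirtinger_mul h1 h1]
    ring
  have hfd := hf.differentiableAt two_ne_zero
  have hgd := hg.differentiableAt two_ne_zero
  rw [(wirtinger_congr h1).self_of_nhds, wirtinger_mul hfd, h0]
  · ring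
  · exact (((ContDiffAt.differentiableAt_wirtinger hf).const_mul 2).fun_mul hgd).fun_add
      (hfd.fun_mul (ContDiffAt.differentiableAt_wirtinger hg))

theorem wirtinger_sq_mul (hf : DifferentiableAt ℝ f z) (hg : DifferentiableAt ℝ g z)
    (h0 : f z = 0) : wirtinger c j (fun y => f y ^ 2 * g y) z = 0 := by
  simp only [pow_two]
  rw [wirtinger_mul (hf.fun_mul hf) hg, wirtinger_mul hf hf, h0]
  ring

/-! ### Matrix-valued functions -/

/-- The entrywise Wirtinger derivative of a matrix-valued function. -/
def wirtingerMatrix (c : ℂ) (j : Fin n) (H : (Fin n → ℂ) → Matrix (Fin r) (Fin r) ℂ)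
    (z : Fin n → ℂ) : Matrix (Fin r) (Fin r) ℂ :=
  Matrix.of fun a b => wirtinger c j (fun y => H y a b) z

variable {H : (Fin n → ℂ) → Matrix (Fin r) (Fin r) ℂ}

theorem differentiableAt_det (hH : ∀ a b, DifferentiableAt ℝ (fun y => H y a b) z) :
    DifferentiableAt ℝ (fun y => (H y).det) z := by
  simp only [Matrix.det_apply]
  refine DifferentiableAt.fun_sum fun σ _ => ?_
  refine DifferentiableAt.const_smul ?_ _
  exact (HasFDerivAt.finsetProd fun i _ => (hH (σ i) i).hasFDerivAt).differentiableAt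

theorem differentiableAt_inv (hH : ∀ a b, DifferentiableAt ℝ (fun y => H y a b) z)
    (hdet : (H z).det ≠ 0) (a b : Fin r) : DifferentiableAt ℝ (fun y => (H y)⁻¹ a b) z := by
  simp only [Matrix.inv_def, Matrix.smul_apply, smul_eq_mul, Ring.inverse_eq_inv,
    Matrix.adjugate_apply]
  refine ((differentiableAt_det hH).fun_inv hdet).mul (differentiableAt_det fun i j => ?_)
  by_cases hi : i = b
  · subst hi
    simp
  · simpa [Matrix.updateRow_ne hi] using hH i j

theorem wirtingerMatrix_mul {K : (Fin n → ℂ) → Matrix (Fin r) (Fin r) ℂ}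
    (hK : ∀ a b, DifferentiableAt ℝ (fun y => K y a b) z)
    (hH : ∀ a b, DifferentiableAt ℝ (fun y => H y a b) z) :
    wirtingerMatrix c j (fun y => K y * H y) z =
      wirtingerMatrix c j K z * H z + K z * wirtingerMatrix c j H z := by
  ext a b
  simp only [wirtingerMatrix, Matrix.of_apply, Matrix.mul_apply, Matrix.add_apply]
  rw [wirtinger_sum _ fun d _ => (hK a d).fun_mul (hH d b), ← Finset.sum_add_distrib]
  exact Finset.sum_congr rfl fun d _ => wirtinger_mul (hK a d) (hH d b)

/-- Obtained by differentiating `H⁻¹ H = 1`, valid near `z` since the determinant is continuous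
there. -/
theorem wirtingerMatrix_inv (hH : ∀ a b, DifferentiableAt ℝ (fun y => H y a b) z)
    (hdet : (H z).det ≠ 0) :
    wirtingerMatrix c j (fun y => (H y)⁻¹) z =
      -((H z)⁻¹ * wirtingerMatrix c j H z * (H z)⁻¹) := by
  have h1 : ∀ᶠ y in 𝓝 z, (H y)⁻¹ * H y = 1 :=
    ((differentiableAt_det hH).continuousAt.eventually_ne hdet).mono fun y hy =>
      Matrix.nonsing_inv_mul _ (isUnit_iff_ne_zero.2 hy)
  have h2 : wirtingerMatrix c j (fun y => (H y)⁻¹ * H y) z = 0 := by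
    ext a b
    have : (fun y => ((H y)⁻¹ * H y) a b) =ᶠ[𝓝 z] fun _ => (1 : Matrix (Fin r) (Fin r) ℂ) a b :=
      h1.mono fun y hy => congrFun (congrFun hy a) b
    simp only [wirtingerMatrix, Matrix.of_apply, Matrix.zero_apply]
    rw [(wirtinger_congr this).self_of_nhds, wirtinger_const]
  rw [wirtingerMatrix_mul (differentiableAt_inv hH hdet) hH] at h2
  have h3 := congrArg (· * (H z)⁻¹) (eq_neg_of_add_eq_zero_left h2)
  simpa [mul_assoc, Matrix.mul_nonsing_inv _ (isUnit_iff_ne_zero.2 hdet)] using h3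

/-- The `\bar∂_k`-derivative of `H⁻¹ ∂_j H`. -/
theorem wirtingerMatrix_conn (hH : ∀ a b, ContDiffAt ℝ 2 (fun y => H y a b) z)
    (hdet : (H z).det ≠ 0) :
    wirtingerMatrix c k (fun y => (H y)⁻¹ * wirtingerMatrix c' j H y) z =
      (H z)⁻¹ * wirtingerMatrix c k (wirtingerMatrix c' j H) z -
        (H z)⁻¹ * wirtingerMatrix c k H z * (H z)⁻¹ * wirtingerMatrix c' j H z := by
  have hd : ∀ a b, DifferentiableAt ℝ (fun y => H y a b) z :=
    fun a b => (hH a b).differentiableAt two_ne_zero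
  rw [wirtingerMatrix_mul (H := wirtingerMatrix c' j H) (differentiableAt_inv hd hdet)
    fun a b => ContDiffAt.differentiableAt_wirtinger (hH a b), wirtingerMatrix_inv hd hdet]
  rw [neg_mul, add_comm, ← sub_eq_add_neg]

end Wirtinger

/-! ## The curvature -/

section CoordDomain

variable {n r : ℕ} {X : Type*} [TopologicalSpace X] [ChartedSpace (Fin n → ℂ) X]
  {V : X → Type*}
  [∀ x, TopologicalSpace (V x)] [TopologicalSpace (Bundle.TotalSpace (Fin r → ℂ) V)]
  [FiberBundle (Fin r → ℂ) V]

theorem isOpen_coordDomain (p : X) : IsOpen (coordDomain (n := n) (r := r) V p) :=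
  (chartAt (Fin n → ℂ) p).continuousOn_symm.isOpen_inter_preimage
    (chartAt (Fin n → ℂ) p).open_target (trivializationAt (Fin r → ℂ) V p).open_baseSet

theorem mem_coordDomain (p : X) :
    chartAt (Fin n → ℂ) p p ∈ coordDomain (n := n) (r := r) V p := by
  refine ⟨mem_chart_target _ _, ?_⟩
  rw [Set.mem_preimage, (chartAt (Fin n → ℂ) p).left_inv (mem_chart_source _ _)]
  exact FiberBundle.mem_baseSet_trivializationAt' p

theorem contDiffAt_of_coordDomain {p : X} {g : (Fin n → ℂ) → ℂ}
    (hg : ContDiffOn ℝ ∞ g (coordDomain (r := r) V p)) :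
    ContDiffAt ℝ 2 g (chartAt (Fin n → ℂ) p p) :=
  (hg.contDiffAt ((isOpen_coordDomain p).mem_nhds (mem_coordDomain p))).of_le
    (WithTop.coe_le_coe.2 le_top)

end CoordDomain

section Curvature

variable {n r : ℕ} {X : Type*} [TopologicalSpace X] [ChartedSpace (Fin n → ℂ) X]
  {V : X → Type*} [∀ x, AddCommGroup (V x)] [∀ x, Module ℂ (V x)]
  [∀ x, TopologicalSpace (V x)] [TopologicalSpace (Bundle.TotalSpace (Fin r → ℂ) V)]
  [FiberBundle (Fin r → ℂ) V]

/-- The coefficient of `d\bar z_k ∧ dz_j` in the curvature at `p`. -/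
def curvatureCoeff (h : ∀ x, V x →ₗ⋆[ℂ] V x →ₗ[ℂ] ℂ) (p : X) (k j : Fin n) :
    Matrix (Fin r) (Fin r) ℂ :=
  wirtingerMatrix Complex.I k (fun z => connMatrix h p j z) (chartAt (Fin n → ℂ) p p)

/-- A complex matrix as a matrix of forms of degree zero. -/
def constMatrix : Matrix (Fin r) (Fin r) ℂ →ₐ[ℂ] Matrix (Fin r) (Fin r) (CentralForm n) :=
  (Algebra.ofId ℂ (CentralForm n)).mapMatrix

/-- The curvature as a matrix of central forms. -/
def centralCurvature (h : ∀ x, V x →ₗ⋆[ℂ] V x →ₗ[ℂ] ℂ) (p : X) :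
    Matrix (Fin r) (Fin r) (CentralForm n) :=
  ∑ k : Fin n, ∑ j : Fin n, twoForm (dzbar k) (dz j) •
    constMatrix (n := n) (curvatureCoeff (r := r) h p k j)

theorem curvature_eq (h : ∀ x, V x →ₗ⋆[ℂ] V x →ₗ[ℂ] ℂ) (p : X) :
    curvature (n := n) (r := r) h p = extMatrix (centralCurvature h p) := by
  ext a b
  simp only [curvature, centralCurvature, extMatrix, map_sum, Matrix.of_apply, Matrix.sum_apply]
  refine Finset.sum_congr rfl fun k _ => Finset.sum_congr rfl fun j _ => ?_
  change _ = ((twoForm (dzbar k) (dz j) * algebraMap ℂ (CentralForm n)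
    (curvatureCoeff h p k j a b) : CentralForm n) : Ext n)
  rw [mul_comm, ← Algebra.smul_def]
  rfl

theorem connMatrix_eq (h : ∀ x, V x →ₗ⋆[ℂ] V x →ₗ[ℂ] ℂ) (p : X) (j : Fin n) :
    connMatrix (r := r) h p j =
      fun z => (gram h p z)⁻¹ * wirtingerMatrix (-Complex.I) j (gram h p) z := by
  funext z
  simp only [connMatrix, wirt_eq_wirtinger]
  rfl

theorem curvatureCoeff_eq {h : ∀ x, V x →ₗ⋆[ℂ] V x →ₗ[ℂ] ℂ} {p : X}
    (hH : ∀ a b : Fin r, ContDiffAt ℝ 2 (fun y => gram h p y a b) (chartAt (Fin n → ℂ) p p))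
    (hdet : (gramAt (n := n) (r := r) h p).det ≠ 0) (k j : Fin n) :
    curvatureCoeff h p k j =
      (gramAt (n := n) (r := r) h p)⁻¹ *
        wirtingerMatrix Complex.I k (wirtingerMatrix (-Complex.I) j (gram h p))
          (chartAt (Fin n → ℂ) p p) -
      (gramAt (n := n) h p)⁻¹ * wirtingerMatrix Complex.I k (gram h p) (chartAt (Fin n → ℂ) p p) *
        (gramAt (n := n) h p)⁻¹ *
          wirtingerMatrix (-Complex.I) j (gram h p) (chartAt (Fin n → ℂ) p p) := by
  rw [curvatureCoeff, connMatrix_eq]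
  exact wirtingerMatrix_conn hH hdet

/-! ### Gram matrices -/

theorem gram_conj {h : ∀ x, V x →ₗ⋆[ℂ] V x →ₗ[ℂ] ℂ}
    (hh : IsHermitianMetric (n := n) (r := r) h) (p : X) (z : Fin n → ℂ) (a b : Fin r) :
    starRingEnd ℂ (gram h p z a b) = gram h p z b a :=
  hh.conj_symm _ _ _

theorem gramAt_isHermitian {h : ∀ x, V x →ₗ⋆[ℂ] V x →ₗ[ℂ] ℂ}
    (hh : IsHermitianMetric (n := n) (r := r) h) (p : X) :
    (gramAt (n := n) (r := r) h p).IsHermitian := by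
  ext a b
  exact gram_conj hh p _ b a

variable [VectorBundle ℂ (Fin r → ℂ) V]

theorem eq_sum_frame {p x : X} (hx : x ∈ (trivializationAt (Fin r → ℂ) V p).baseSet) (v : V x) :
    v = ∑ a, ((trivializationAt (Fin r → ℂ) V p) ⟨x, v⟩).2 a • frame p a x := by
  set e := trivializationAt (Fin r → ℂ) V p with he
  conv_lhs => rw [← e.symm_apply_apply_mk hx v, ← e.coe_symmₗ (R := ℂ) hx,
    pi_eq_sum_univ' (e ⟨x, v⟩).2, map_sum]
  refine Finset.sum_congr rfl fun a _ => ?_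
  rw [map_smul, e.coe_symmₗ (R := ℂ) hx]
  rfl

theorem endMatrix_frame (s : ∀ x, V x →ₗ[ℂ] V x) {p : X} {z : Fin n → ℂ}
    (hz : z ∈ coordDomain (r := r) V p) (b : Fin r) :
    s ((chartAt (Fin n → ℂ) p).symm z) (frame p b ((chartAt (Fin n → ℂ) p).symm z)) =
      ∑ a, endMatrix s p z a b • frame p a ((chartAt (Fin n → ℂ) p).symm z) :=
  eq_sum_frame hz.2 _

/-- A kernel vector of the Gram matrix would give, in the frame, a nonzero vector of the fibre with
`h v v = 0`. -/
theorem gramAt_det_ne_zero {h : ∀ x, V x →ₗ⋆[ℂ] V x →ₗ[ℂ] ℂ}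
    (hh : IsHermitianMetric (n := n) (r := r) h) (p : X) :
    (gramAt (n := n) (r := r) h p).det ≠ 0 := by
  intro h0
  rw [← Matrix.exists_mulVec_eq_zero_iff] at h0
  obtain ⟨x, hx, h0⟩ := h0
  set q := (chartAt (Fin n → ℂ) p).symm (chartAt (Fin n → ℂ) p p) with hq
  set e := trivializationAt (Fin r → ℂ) V p with he
  have hb : q ∈ e.baseSet := (mem_coordDomain (n := n) (r := r) (V := V) p).2
  have hv : e.symm q x = ∑ a, x a • frame p a q := by
    conv_lhs => rw [← e.coe_symmₗ (R := ℂ) hb, pi_eq_sum_univ' x, map_sum]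
    refine Finset.sum_congr rfl fun a _ => ?_
    rw [map_smul, e.coe_symmₗ (R := ℂ) hb]
    rfl
  have hv0 : e.symm q x ≠ 0 := by
    intro h1
    apply hx
    rw [← e.coe_symmₗ (R := ℂ) hb] at h1
    have := congrArg (e.linearMapAt ℂ q) h1
    rwa [e.linearMapAt_symmₗ hb, map_zero] at this
  have hpos := hh.pos q _ hv0
  have hzero : h q (e.symm q x) (e.symm q x) = 0 := by
    rw [hv]
    simp only [map_sum, LinearMap.sum_apply, map_smulₛₗ, LinearMap.smul_apply, smul_eq_mul,
      Finset.mul_sum]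
    rw [Finset.sum_comm]
    refine Finset.sum_eq_zero fun a _ => ?_
    have h2 := congrFun h0 a
    simp only [Matrix.mulVec, dotProduct, Pi.zero_apply] at h2
    have h3 : ∀ b, gramAt (n := n) (r := r) h p a b = h q (frame p a q) (frame p b q) :=
      fun b => rfl
    simp only [h3] at h2
    rw [← mul_zero (starRingEnd ℂ (x a)), ← h2, Finset.mul_sum]
    refine Finset.sum_congr rfl fun b _ => ?_
    simp only [RingHom.id_apply]
    ring
  rw [hzero] at hpos
  simp at hpos

end Curvature

end ZCritical

end

noncomputable section

namespace ZCritical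

/-! ## Hermitian matrices of forms -/

section HermitianForms

variable {n r : ℕ}

/-- The conjugate transpose of a matrix of central forms. -/
def conjTransposeForm :
    Matrix (Fin r) (Fin r) (CentralForm n) →+ Matrix (Fin r) (Fin r) (CentralForm n) :=
  (Matrix.transposeAddEquiv _ _ _).toAddMonoidHom.comp
    (conjCentral (n := n)).toAddMonoidHom.mapMatrix

theorem conjTransposeForm_apply (A : Matrix (Fin r) (Fin r) (CentralForm n)) (a b : Fin r) :
    conjTransposeForm A a b = conjCentral (A b a) := rfl

theorem conjTransposeForm_mul (A B : Matrix (Fin r) (Fin r) (CentralForm n)) :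
    conjTransposeForm (A * B) = conjTransposeForm B * conjTransposeForm A := by
  ext1 a b
  simp only [conjTransposeForm_apply, Matrix.mul_apply, map_sum, map_mul]
  exact Finset.sum_congr rfl fun c _ => mul_comm _ _

theorem conjTransposeForm_smul (c : CentralForm n) (A : Matrix (Fin r) (Fin r) (CentralForm n)) :
    conjTransposeForm (c • A) = conjCentral c • conjTransposeForm A := by
  ext1 a b
  simp only [conjTransposeForm_apply, Matrix.smul_apply, smul_eq_mul, map_mul]

theorem conjTransposeForm_complex_smul (c : ℂ) (A : Matrix (Fin r) (Fin r) (CentralForm n)) :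
    conjTransposeForm (c • A) = starRingEnd ℂ c • conjTransposeForm A := by
  ext1 a b
  simp only [conjTransposeForm_apply, Matrix.smul_apply, conjCentral_smul]

theorem constMatrix_apply (M : Matrix (Fin r) (Fin r) ℂ) (a b : Fin r) :
    constMatrix (n := n) M a b = algebraMap ℂ (CentralForm n) (M a b) := rfl

theorem conjTransposeForm_constMatrix (M : Matrix (Fin r) (Fin r) ℂ) :
    conjTransposeForm (n := n) (constMatrix M) = constMatrix Mᴴ := by
  ext1 a b
  rw [conjTransposeForm_apply, constMatrix_apply, constMatrix_apply,
    Algebra.algebraMap_eq_smul_one, Algebra.algebraMap_eq_smul_one, conjCentral_smul, map_one]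
  rfl

variable {H S : Matrix (Fin r) (Fin r) ℂ} {F : Matrix (Fin r) (Fin r) (CentralForm n)}

theorem conjTransposeForm_pow (hF : conjTransposeForm F * constMatrix H = -(constMatrix H * F))
    (k : ℕ) :
    conjTransposeForm (F ^ k) * constMatrix H = (-1 : ℂ) ^ k • (constMatrix H * F ^ k) := by
  induction k with
  | zero =>
    have : conjTransposeForm (1 : Matrix (Fin r) (Fin r) (CentralForm n)) = 1 := by
      rw [← map_one (constMatrix (n := n) (r := r)), conjTransposeForm_constMatrix,
        Matrix.conjTranspose_one]
    simp [this]
  | succ k ih =>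
    rw [pow_succ', conjTransposeForm_mul, mul_assoc, hF, mul_neg, ← mul_assoc, ih, smul_mul_assoc,
      mul_assoc, ← pow_succ, ← pow_succ', pow_succ (-1 : ℂ), mul_neg_one, neg_smul]
    rfl

theorem conjTransposeForm_wordSum
    (hF : conjTransposeForm F * constMatrix H = -(constMatrix H * F)) (hS : Sᴴ * H = H * S)
    (i : ℕ) : conjTransposeForm (wordSum F (constMatrix S) i) * constMatrix H =
      (-1 : ℂ) ^ i • (constMatrix H * wordSum F (constMatrix S) i) := by
  rw [wordSum, map_sum, Finset.sum_mul]
  -- Taking adjoints reverses each word and so exchanges the two exponents of `F`.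
  conv_rhs => rw [← Finset.Nat.sum_antidiagonal_swap]
  rw [Finset.mul_sum, Finset.smul_sum]
  refine Finset.sum_congr rfl fun x hx => ?_
  rw [← Finset.HasAntidiagonal.mem_antidiagonal.1 hx, conjTransposeForm_mul, conjTransposeForm_mul,
    mul_assoc, mul_assoc, conjTransposeForm_pow hF, mul_smul_comm, mul_smul_comm,
    conjTransposeForm_constMatrix, ← mul_assoc (constMatrix Sᴴ), ← map_mul, hS, map_mul,
    ← mul_assoc, ← mul_assoc, conjTransposeForm_pow hF, smul_mul_assoc, smul_mul_assoc, smul_smul,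
    pow_add]
  simp only [mul_assoc, Prod.fst_swap, Prod.snd_swap]

/-! ### Linear functionals on forms -/

variable (L : CentralForm n →ₗ[ℂ] ℂ)

theorem map_mul_constMatrix (A : Matrix (Fin r) (Fin r) (CentralForm n)) :
    (A * constMatrix H).map L = A.map L * H := by
  ext a b
  simp only [Matrix.map_apply, Matrix.mul_apply, map_sum, constMatrix_apply]
  refine Finset.sum_congr rfl fun c _ => ?_
  rw [mul_comm, ← Algebra.smul_def, map_smul, smul_eq_mul, mul_comm]

theorem map_constMatrix_mul (A : Matrix (Fin r) (Fin r) (CentralForm n)) :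
    (constMatrix H * A).map L = H * A.map L := by
  ext a b
  simp only [Matrix.map_apply, Matrix.mul_apply, map_sum, constMatrix_apply]
  refine Finset.sum_congr rfl fun c _ => ?_
  rw [← Algebra.smul_def, map_smul, smul_eq_mul]

theorem map_conjTransposeForm (hL : ∀ c, L (conjCentral c) = starRingEnd ℂ (L c))
    (A : Matrix (Fin r) (Fin r) (CentralForm n)) :
    (conjTransposeForm A).map L = (A.map L)ᴴ := by
  ext a b
  exact hL _

theorem map_mem_hermEnd (hL : ∀ c, L (conjCentral c) = starRingEnd ℂ (L c))
    {A : Matrix (Fin r) (Fin r) (CentralForm n)}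
    (hA : conjTransposeForm A * constMatrix H = constMatrix H * A) :
    A.map L ∈ hermEnd H := by
  change (A.map L)ᴴ * H = H * A.map L
  rw [← map_conjTransposeForm L hL, ← map_mul_constMatrix, hA, map_constMatrix_mul]

theorem trace_map_mul (A : Matrix (Fin r) (Fin r) (CentralForm n)) :
    (A.map L * S).trace = L (A * constMatrix S).trace := by
  rw [← map_mul_constMatrix]
  simp [Matrix.trace]

/-! ### The first variation of the Chern character form -/

/-- The coefficient `(i/2π)^j / j!` of `F^j` in `exp(iF/2π)`. -/
def chernCoeff (j : ℕ) : ℂ := (Complex.I / (2 * Real.pi)) ^ j / (j.factorial : ℂ)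

theorem conj_chernCoeff (j : ℕ) : starRingEnd ℂ (chernCoeff j) = (-1) ^ j * chernCoeff j := by
  simp only [chernCoeff, map_div₀, map_pow, map_mul, Complex.conj_I, map_ofNat, Complex.conj_ofReal,
    map_natCast]
  rw [neg_div, neg_pow]
  ring

/-- `exp(iF/2π)`, truncated at degree `n`. -/
def expForm (F : Matrix (Fin r) (Fin r) (CentralForm n)) :
    Matrix (Fin r) (Fin r) (CentralForm n) :=
  ∑ j ∈ Finset.range (n + 1), chernCoeff j • F ^ j

/-- The sum, with the coefficients of `exp(iF/2π)`, of the words with one letter `S`. -/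
def expVariation (F S : Matrix (Fin r) (Fin r) (CentralForm n)) :
    Matrix (Fin r) (Fin r) (CentralForm n) :=
  ∑ i ∈ Finset.range n, chernCoeff (i + 1) • wordSum F S i

theorem expForm_add_smul {ε : CentralForm n} (hε : ε * ε = 0)
    (F S : Matrix (Fin r) (Fin r) (CentralForm n)) :
    expForm (F + ε • S) = expForm F + ε • expVariation F S := by
  rw [expForm, expForm, expVariation, Finset.sum_range_succ', Finset.sum_range_succ' _ n,
    pow_zero, pow_zero, Finset.smul_sum, add_right_comm, ← Finset.sum_add_distrib]
  congr 1
  refine Finset.sum_congr rfl fun i _ => ?_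
  rw [add_smul_pow_succ hε, smul_add, smul_comm ε]

/-- Three signs cancel: `-1` from conjugating `w ∧ w̄`, `(-1)^(i+1)` from the power of `i/2π`, and
`(-1)^i` from the `i` skew-Hermitian letters of the word. -/
theorem conjTransposeForm_expVariation
    (hF : conjTransposeForm F * constMatrix H = -(constMatrix H * F)) (hS : Sᴴ * H = H * S)
    (w : Covector n) :
    conjTransposeForm (twoForm w (conjCovector w) • expVariation F (constMatrix S)) *
        constMatrix H =
      constMatrix H * (twoForm w (conjCovector w) • expVariation F (constMatrix S)) := by
  rw [conjTransposeForm_smul, conjCentral_twoForm, conjCovector_conjCovector, twoForm_swap,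
    smul_mul_assoc, mul_smul_comm, neg_smul, ← smul_neg]
  congr 1
  rw [expVariation, map_sum, Finset.sum_mul, Finset.mul_sum, ← Finset.sum_neg_distrib]
  refine Finset.sum_congr rfl fun i _ => ?_
  rw [conjTransposeForm_complex_smul, smul_mul_assoc, conjTransposeForm_wordSum hF hS,
    mul_smul_comm, smul_smul, conj_chernCoeff, ← neg_smul]
  congr 1
  have : ((-1 : ℂ) ^ i) * (-1) ^ i = 1 := by rw [← mul_pow]; simp
  rw [pow_succ]
  linear_combination (chernCoeff (i + 1)) * this

end HermitianForms

/-! ## Imaginary parts -/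

section ImPart

variable {r : ℕ} {H : Matrix (Fin r) (Fin r) ℂ}

theorem imPart_add (A B : Matrix (Fin r) (Fin r) ℂ) :
    imPart H (A + B) = imPart H A + imPart H B := by
  simp only [imPart, Matrix.conjTranspose_add, mul_add, add_mul, ← smul_add]
  congr 1
  abel

theorem imPart_sum {ι : Type*} (s : Finset ι) (A : ι → Matrix (Fin r) (Fin r) ℂ) :
    imPart H (∑ i ∈ s, A i) = ∑ i ∈ s, imPart H (A i) := by
  refine map_sum (AddMonoidHom.mk' (imPart H) imPart_add) A s

/-- This is the origin of the real numbers `Im(e^{-iφ} ρ_d)` in the symbol: on a Hermitian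
endomorphism only the scalar contributes a skew part. -/
theorem imPart_smul_of_mem_hermEnd (hdet : H.det ≠ 0) {A : Matrix (Fin r) (Fin r) ℂ}
    (hA : A ∈ hermEnd H) (c : ℂ) : imPart H (c • A) = (Complex.I * (c.im : ℂ)) • A := by
  have hA' : Aᴴ * H = H * A := hA
  rw [imPart, Matrix.conjTranspose_smul, mul_smul_comm, smul_mul_assoc, mul_assoc, hA',
    ← mul_assoc, Matrix.nonsing_inv_mul _ (isUnit_iff_ne_zero.2 hdet), one_mul, ← sub_smul,
    smul_smul]
  congr 1
  apply Complex.ext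
  · simp
  · simp
    ring

theorem imPart_real_smul (t : ℝ) (A : Matrix (Fin r) (Fin r) ℂ) :
    imPart H ((t : ℂ) • A) = (t : ℂ) • imPart H A := by
  rw [imPart, imPart, Matrix.conjTranspose_smul, Complex.star_def, Complex.conj_ofReal,
    mul_smul_comm, smul_mul_assoc, ← smul_sub, smul_comm]

theorem I_smul_mem_skewEnd {A : Matrix (Fin r) (Fin r) ℂ} (hA : A ∈ hermEnd H) (t : ℝ) :
    (Complex.I * (t : ℂ)) • A ∈ skewEnd H := by
  have hA' : Aᴴ * H = H * A := hA
  change ((Complex.I * (t : ℂ)) • A)ᴴ * H = -(H * ((Complex.I * (t : ℂ)) • A))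
  rw [Matrix.conjTranspose_smul, smul_mul_assoc, hA', mul_smul_comm]
  simp

/-- Multiplication by `i` exchanges the two spaces; as a result injectivity of the symbol suffices
for bijectivity. -/
theorem finrank_hermEnd_eq (H : Matrix (Fin r) (Fin r) ℂ) :
    Module.finrank ℝ (hermEnd H) = Module.finrank ℝ (skewEnd H) := by
  refine LinearEquiv.finrank_eq
    { toFun := fun A => ⟨(Complex.I * ((1 : ℝ) : ℂ)) • (A : Matrix (Fin r) (Fin r) ℂ),
        I_smul_mem_skewEnd A.2 1⟩
      invFun := fun A => ⟨(-Complex.I) • (A : Matrix (Fin r) (Fin r) ℂ), ?_⟩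
      map_add' := fun A B => Subtype.ext (smul_add _ _ _)
      map_smul' := fun c A => Subtype.ext (smul_comm _ _ _)
      left_inv := fun A => Subtype.ext (by simp [smul_smul])
      right_inv := fun A => Subtype.ext (by simp [smul_smul]) }
  have hA : (A : Matrix (Fin r) (Fin r) ℂ)ᴴ * H = -(H * A) := A.2
  change ((-Complex.I) • (A : Matrix (Fin r) (Fin r) ℂ))ᴴ * H = H * _
  rw [Matrix.conjTranspose_smul, smul_mul_assoc, hA, mul_smul_comm]
  simp

end ImPart

/-! ## The `(0,1)`-part of a real covector -/

section ZeroOne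

variable {n : ℕ}

/-- The `(0,1)`-part of a real covector. -/
def zeroOnePart (ξ : (Fin n → ℂ) →L[ℝ] ℝ) : Covector n :=
  ∑ k : Fin n, ((1 / 2 : ℂ) * ((ξ (Pi.single k 1) : ℂ) +
    Complex.I * (ξ (Pi.single k Complex.I) : ℂ))) • dzbar k

theorem conjCovector_zeroOnePart (ξ : (Fin n → ℂ) →L[ℝ] ℝ) :
    conjCovector (zeroOnePart ξ) = ∑ k : Fin n, ((1 / 2 : ℂ) * ((ξ (Pi.single k 1) : ℂ) +
      -Complex.I * (ξ (Pi.single k Complex.I) : ℂ))) • dz k := by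
  rw [zeroOnePart, conjCovector_sum]
  refine Finset.sum_congr rfl fun k _ => ?_
  rw [conjCovector_smul, dzbar, conjCovector_conjCovector]
  simp only [map_mul, map_add, map_div₀, map_one, map_ofNat, Complex.conj_ofReal, Complex.conj_I]

theorem isZeroOne_zeroOnePart (ξ : (Fin n → ℂ) →L[ℝ] ℝ) : IsZeroOne (zeroOnePart ξ) := by
  intro v
  simp only [zeroOnePart, LinearMap.sum_apply, LinearMap.smul_apply, dzbar, conjCovector_apply,
    dz, LinearMap.coe_mk, AddHom.coe_mk, Pi.smul_apply, smul_eq_mul, map_mul, Complex.conj_I,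
    Finset.mul_sum]
  refine Finset.sum_congr rfl fun k _ => ?_
  ring

theorem zeroOnePart_single (ξ : (Fin n → ℂ) →L[ℝ] ℝ) (k : Fin n) :
    zeroOnePart ξ (Pi.single k 1) = (1 / 2 : ℂ) * ((ξ (Pi.single k 1) : ℂ) +
      Complex.I * (ξ (Pi.single k Complex.I) : ℂ)) := by
  simp only [zeroOnePart, LinearMap.sum_apply, LinearMap.smul_apply, dzbar, conjCovector_apply,
    dz, LinearMap.coe_mk, AddHom.coe_mk, smul_eq_mul]
  rw [Finset.sum_eq_single k]
  · simp
  · intro j _ hj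
    simp [Pi.single_eq_of_ne hj]
  · simp

theorem IsZeroOne.ext {v w : Covector n} (hv : IsZeroOne v) (hw : IsZeroOne w)
    (h : ∀ k, v (Pi.single k 1) = w (Pi.single k 1)) : v = w := by
  apply LinearMap.ext
  intro x
  rw [pi_eq_sum_univ' x, map_sum, map_sum]
  refine Finset.sum_congr rfl fun k _ => ?_
  simp only [complex_smul_eq (x k), map_add, LinearMap.map_smul, hv _, hw _, h]

theorem zeroOnePart_ne_zero {ξ : (Fin n → ℂ) →L[ℝ] ℝ} (hξ : ξ ≠ 0) : zeroOnePart ξ ≠ 0 := by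
  intro h0
  apply hξ
  have h1 : ∀ k, ξ (Pi.single k 1) = 0 ∧ ξ (Pi.single k Complex.I) = 0 := by
    intro k
    have := zeroOnePart_single ξ k
    rw [h0] at this
    have hre := congrArg Complex.re this
    have him := congrArg Complex.im this
    simp at hre him
    exact ⟨hre, him⟩
  ext x
  rw [pi_eq_sum_univ' x, map_sum]
  refine Finset.sum_eq_zero fun k _ => ?_
  rw [complex_smul_eq, map_add, map_smul, map_smul, (h1 k).1,
    show Complex.I • (Pi.single k 1 : Fin n → ℂ) = Pi.single k Complex.I by
      rw [← Pi.single_smul]; simp, (h1 k).2]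
  simp

/-- Every covector of type `(0,1)` is the `(0,1)`-part of a real covector. -/
theorem exists_zeroOnePart_eq {w : Covector n} (hw : IsZeroOne w) :
    ∃ ξ : (Fin n → ℂ) →L[ℝ] ℝ, zeroOnePart ξ = w := by
  -- The real covector is `w + w̄ = 2 Re w`.
  refine ⟨LinearMap.toContinuousLinearMap ((2 : ℝ) • (Complex.reLm ∘ₗ w)),
    (isZeroOne_zeroOnePart _).ext hw fun k => ?_⟩
  rw [zeroOnePart_single]
  have h : w (Pi.single k Complex.I) = -Complex.I * w (Pi.single k 1) := by
    rw [← hw, ← Pi.single_smul]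
    simp
  simp only [LinearMap.coe_toContinuousLinearMap', LinearMap.smul_apply, LinearMap.comp_apply,
    Complex.reLm_coe, h]
  apply Complex.ext <;> simp

end ZeroOne

end ZCritical

end

noncomputable section

namespace ZCritical

open Filter Topology

/-! ### Derivatives of a perturbation `g + t f² m` at a zero of `f`, and conjugation. -/

section Wirtinger

variable {n r : ℕ} {c c' : ℂ} {j k : Fin n} {z : Fin n → ℂ}

theorem wirtinger_add_sq_mul {g f m : (Fin n → ℂ) → ℂ} (hg : ContDiffAt ℝ 2 g z)
    (hf : ContDiffAt ℝ 2 f z) (hm : ContDiffAt ℝ 2 m z) (h0 : f z = 0) (t : ℂ) :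
    wirtinger c j (fun y => g y + t * (f y ^ 2 * m y)) z = wirtinger c j g z := by
  have hf' := hf.differentiableAt two_ne_zero
  have hm' := hm.differentiableAt two_ne_zero
  rw [wirtinger_add (hg.differentiableAt two_ne_zero) (((hf'.fun_pow 2).fun_mul hm').const_mul t),
    wirtinger_mul (differentiableAt_const t) ((hf'.fun_pow 2).fun_mul hm'), wirtinger_const,
    wirtinger_sq_mul hf' hm' h0]
  ring

theorem wirtinger_wirtinger_add_sq_mul {g f m : (Fin n → ℂ) → ℂ} (hg : ContDiffAt ℝ 2 g z)
    (hf : ContDiffAt ℝ 2 f z) (hm : ContDiffAt ℝ 2 m z) (h0 : f z = 0) (t : ℂ) :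
    wirtinger c j (wirtinger c' k fun y => g y + t * (f y ^ 2 * m y)) z =
      wirtinger c j (wirtinger c' k g) z +
        t * (2 * wirtinger c j f z * wirtinger c' k f z * m z) := by
  have hfm : ContDiffAt ℝ 2 (fun y => f y ^ 2 * m y) z := (hf.pow 2).mul hm
  have h1 : (wirtinger c' k fun y => g y + t * (f y ^ 2 * m y)) =ᶠ[𝓝 z]
      fun y => wirtinger c' k g y + t * wirtinger c' k (fun y => f y ^ 2 * m y) y := by
    filter_upwards [hg.eventually (by simp), hfm.eventually (by simp)] with y h1 h2
    rw [wirtinger_add (h1.differentiableAt two_ne_zero)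
        ((h2.differentiableAt two_ne_zero).const_mul t),
      wirtinger_mul (differentiableAt_const t) (h2.differentiableAt two_ne_zero), wirtinger_const]
    ring
  have h2 := ContDiffAt.differentiableAt_wirtinger (c := c') (j := k) hfm
  rw [(wirtinger_congr h1).self_of_nhds,
    wirtinger_add (ContDiffAt.differentiableAt_wirtinger hg) (h2.const_mul t),
    wirtinger_mul (differentiableAt_const t) h2, wirtinger_const,
    wirtinger_wirtinger_sq_mul hf hm h0]
  ring

theorem wirtingerMatrix_conjTranspose {H : (Fin n → ℂ) → Matrix (Fin r) (Fin r) ℂ}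
    (hH : ∀ a b, DifferentiableAt ℝ (fun y => H y a b) z) :
    (wirtingerMatrix c j H z)ᴴ =
      wirtingerMatrix (starRingEnd ℂ c) j (fun y => (H y)ᴴ) z := by
  ext a b
  have := wirtinger_conj (c := starRingEnd ℂ c) (j := j) (hH b a)
  rw [Complex.conj_conj] at this
  exact this.symm

theorem wirtingerMatrix_congr {H H' : (Fin n → ℂ) → Matrix (Fin r) (Fin r) ℂ}
    (h : H =ᶠ[𝓝 z] H') : wirtingerMatrix c j H z = wirtingerMatrix c j H' z := by
  ext a b
  exact (wirtinger_congr (h.mono fun y hy => congrFun (congrFun hy a) b)).self_of_nhds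

theorem wirtingerMatrix_wirtingerMatrix_conjTranspose
    {H : (Fin n → ℂ) → Matrix (Fin r) (Fin r) ℂ}
    (hH : ∀ a b, ContDiffAt ℝ 2 (fun y => H y a b) z) (hherm : ∀ y, (H y)ᴴ = H y) :
    (wirtingerMatrix c k (wirtingerMatrix c' j H) z)ᴴ =
      wirtingerMatrix (starRingEnd ℂ c') j (wirtingerMatrix (starRingEnd ℂ c) k H) z := by
  have h1 : (fun y => (wirtingerMatrix c' j H y)ᴴ) =ᶠ[𝓝 z]
      wirtingerMatrix (starRingEnd ℂ c') j H := by
    have : ∀ᶠ y in 𝓝 z, ∀ a b, ContDiffAt ℝ 2 (fun y => H y a b) y :=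
      eventually_all.2 fun a => eventually_all.2 fun b => (hH a b).eventually (by simp)
    filter_upwards [this] with y hy
    rw [wirtingerMatrix_conjTranspose fun a b => (hy a b).differentiableAt two_ne_zero]
    simp only [hherm]
  rw [wirtingerMatrix_conjTranspose (H := wirtingerMatrix c' j H)
      fun a b => ContDiffAt.differentiableAt_wirtinger (hH a b),
    wirtingerMatrix_congr h1]
  ext a b
  exact wirtinger_comm (hH a b)

/-- The Wirtinger derivatives of a real function. -/
theorem wirtinger_ofReal {f : (Fin n → ℂ) → ℝ} (hf : DifferentiableAt ℝ f z) :
    wirtinger c j (fun y => (f y : ℂ)) z = (1 / 2 : ℂ) * ((fderiv ℝ f z (Pi.single j 1) : ℂ) +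
      c * (fderiv ℝ f z (Pi.single j Complex.I) : ℂ)) := by
  have h : HasFDerivAt (fun y => (f y : ℂ)) (Complex.ofRealCLM.comp (fderiv ℝ f z)) z :=
    Complex.ofRealCLM.hasFDerivAt.comp z hf.hasFDerivAt
  rw [wirtinger, h.fderiv]
  rfl

end Wirtinger

section Bundles

variable {n r : ℕ} {X : Type*} [TopologicalSpace X] [ChartedSpace (Fin n → ℂ) X]
  {V : X → Type*} [∀ x, AddCommGroup (V x)] [∀ x, Module ℂ (V x)]
  [∀ x, TopologicalSpace (V x)] [TopologicalSpace (Bundle.TotalSpace (Fin r → ℂ) V)]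
  [FiberBundle (Fin r → ℂ) V] [VectorBundle ℂ (Fin r → ℂ) V]
  {h : ∀ x, V x →ₗ⋆[ℂ] V x →ₗ[ℂ] ℂ}

/-! ## The curvature of a Hermitian metric is skew-Hermitian -/

/-- After multiplication by the Gram matrix `H`, the coefficient is `∂̄_k ∂_j H - ∂̄_k H · H⁻¹ · ∂_j
H`. As `H` is Hermitian, conjugate transposition exchanges `k` and `j` in each term. -/
theorem curvatureCoeff_conjTranspose (hh : IsHermitianMetric (n := n) (r := r) h) (p : X)
    (k j : Fin n) :
    (curvatureCoeff (r := r) h p k j)ᴴ * gramAt (n := n) h p =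
      gramAt (n := n) h p * curvatureCoeff h p j k := by
  have hH : ∀ a b : Fin r, ContDiffAt ℝ 2 (fun y => gram h p y a b) (chartAt (Fin n → ℂ) p p) :=
    fun a b => contDiffAt_of_coordDomain (hh.smooth p a b)
  have hd : ∀ a b : Fin r,
      DifferentiableAt ℝ (fun y => gram h p y a b) (chartAt (Fin n → ℂ) p p) :=
    fun a b => (hH a b).differentiableAt two_ne_zero
  have hdet := gramAt_det_ne_zero hh p
  have hu := isUnit_iff_ne_zero.2 hdet
  have hherm : ∀ y, (gram (n := n) (r := r) h p y)ᴴ = gram h p y := fun y => by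
    ext a b
    exact gram_conj hh p y b a
  have hinv : ((gramAt (n := n) (r := r) h p)⁻¹)ᴴ = (gramAt (n := n) h p)⁻¹ := by
    rw [Matrix.conjTranspose_nonsing_inv, (gramAt_isHermitian hh p).eq]
  rw [curvatureCoeff_eq hH hdet, curvatureCoeff_eq hH hdet]
  simp only [Matrix.conjTranspose_sub, Matrix.conjTranspose_mul, hinv]
  rw [wirtingerMatrix_wirtingerMatrix_conjTranspose hH hherm, wirtingerMatrix_conjTranspose hd,
    wirtingerMatrix_conjTranspose hd]
  simp only [hherm, map_neg, Complex.conj_I, neg_neg, mul_sub, sub_mul, mul_assoc,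
    Matrix.nonsing_inv_mul _ hu, mul_one, Matrix.mul_nonsing_inv_cancel_left _ _ hu]

theorem conjTransposeForm_centralCurvature (hh : IsHermitianMetric (n := n) (r := r) h) (p : X) :
    conjTransposeForm (centralCurvature (n := n) (r := r) h p) *
        constMatrix (gramAt (n := n) (r := r) h p) =
      -(constMatrix (gramAt (n := n) (r := r) h p) * centralCurvature (n := n) h p) := by
  have h1 : ∀ k j : Fin n, conjTransposeForm (twoForm (dzbar k) (dz j) •
        constMatrix (n := n) (curvatureCoeff (r := r) h p k j)) *
          constMatrix (gramAt (n := n) h p) =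
      -(constMatrix (gramAt (n := n) h p) *
        (twoForm (dzbar j) (dz k) • constMatrix (n := n) (curvatureCoeff (r := r) h p j k))) := by
    intro k j
    -- The minus sign comes from restoring the order of factors in the conjugate of `dz̄_k ∧ dz_j`.
    rw [conjTransposeForm_smul, conjCentral_twoForm, dzbar, conjCovector_conjCovector,
      twoForm_swap, conjTransposeForm_constMatrix, smul_mul_assoc, ← map_mul,
      curvatureCoeff_conjTranspose hh, map_mul, mul_smul_comm, neg_smul]
    rfl
  simp only [centralCurvature, map_sum, Finset.sum_mul, h1]
  rw [Finset.sum_comm]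
  simp only [Finset.mul_sum]
  exact (Finset.sum_congr rfl fun y _ => Finset.sum_neg_distrib _).trans
    (Finset.sum_neg_distrib _)

/-! ## The curvature of a deformed metric -/

variable {f : X → ℝ} {s : ∀ x, V x →ₗ[ℂ] V x} {p : X}

theorem gram_deform {z : Fin n → ℂ} (hz : z ∈ coordDomain (r := r) V p) (t : ℝ) (a b : Fin r) :
    gram (deform h (fun x => ((f x : ℂ) ^ 2) • s x) t) p z a b =
      gram h p z a b + (t : ℂ) * (((f ((chartAt (Fin n → ℂ) p).symm z) : ℝ) : ℂ) ^ 2 *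
        (gram (r := r) h p z * endMatrix (r := r) s p z) a b) := by
  simp only [gram, deform, Matrix.of_apply, LinearMap.add_apply, LinearMap.smul_apply,
    LinearMap.compl₂_apply, map_smul, smul_eq_mul, endMatrix_frame s hz, map_sum, Matrix.mul_apply]
  congr 3
  exact Finset.sum_congr rfl fun c _ => mul_comm _ _

theorem gramAt_deform (h0 : f p = 0) (t : ℝ) :
    gramAt (n := n) (r := r) (deform h (fun x => ((f x : ℂ) ^ 2) • s x) t) p =
      gramAt (n := n) h p := by
  ext a b
  rw [gramAt, gram_deform (mem_coordDomain p),
    (chartAt (Fin n → ℂ) p).left_inv (mem_chart_source _ _), h0]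
  simp [gramAt]

variable {ξ : (Fin n → ℂ) →L[ℝ] ℝ}

/-- Only the mixed second derivative of the Gram matrix changes, by `2t ∂̄_k f ∂_j f` times `H s`,
and the factor `H⁻¹` in the curvature removes `H`. The numbers `∂̄_k f` and `∂_j f` are the
components of the `(0,1)`-part of `ξ` and of its conjugate. The formula is exact for all `t`;
invertibility at `p` persists because the Gram matrix there is unchanged. -/
theorem centralCurvature_deform (hh : IsHermitianMetric (n := n) (r := r) h)
    (hs : IsHermitianSection (n := n) (r := r) h s) (h0 : f p = 0)
    (hf : ContDiffAt ℝ 2 (f ∘ (chartAt (Fin n → ℂ) p).symm) (chartAt (Fin n → ℂ) p p))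
    (hξ : fderiv ℝ (f ∘ (chartAt (Fin n → ℂ) p).symm) (chartAt (Fin n → ℂ) p p) = ξ) (t : ℝ) :
    centralCurvature (n := n) (r := r) (deform h (fun x => ((f x : ℂ) ^ 2) • s x) t) p =
      centralCurvature (n := n) (r := r) h p + ((2 * t : ℂ) •
        twoForm (zeroOnePart ξ) (conjCovector (zeroOnePart ξ))) •
          constMatrix (n := n) (endMatrix (r := r) s p (chartAt (Fin n → ℂ) p p)) := by
  set z₀ := chartAt (Fin n → ℂ) p p with hz₀
  set ht := deform h (fun x => ((f x : ℂ) ^ 2) • s x) t with hht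
  set F : (Fin n → ℂ) → ℂ := fun z => ((f ∘ (chartAt (Fin n → ℂ) p).symm) z : ℂ) with hF
  have hF0 : F z₀ = 0 := by
    simp only [hF, Function.comp_apply, hz₀]
    rw [(chartAt (Fin n → ℂ) p).left_inv (mem_chart_source _ _), h0, Complex.ofReal_zero]
  have hFc : ContDiffAt ℝ 2 F z₀ := Complex.ofRealCLM.contDiff.contDiffAt.comp z₀ hf
  have hH : ∀ a b : Fin r, ContDiffAt ℝ 2 (fun y => gram h p y a b) z₀ :=
    fun a b => contDiffAt_of_coordDomain (hh.smooth p a b)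
  have hM : ∀ a b : Fin r, ContDiffAt ℝ 2
      (fun y => (gram (r := r) h p y * endMatrix (r := r) s p y) a b) z₀ := by
    intro a b
    simp only [Matrix.mul_apply]
    exact ContDiffAt.sum fun d _ => (hH a d).mul (contDiffAt_of_coordDomain (hs.smooth p d b))
  have hev : ∀ a b : Fin r, (fun y => gram (r := r) ht p y a b) =ᶠ[𝓝 z₀] fun y => gram h p y a b +
      (t : ℂ) * (F y ^ 2 * (gram (r := r) h p y * endMatrix (r := r) s p y) a b) := fun a b =>
    Filter.mem_of_superset ((isOpen_coordDomain p).mem_nhds (mem_coordDomain (V := V) p))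
      fun y hy => gram_deform hy t a b
  have hHt : ∀ a b : Fin r, ContDiffAt ℝ 2 (fun y => gram (r := r) ht p y a b) z₀ := fun a b =>
    ((hH a b).add (contDiffAt_const.mul ((hFc.pow 2).mul (hM a b)))).congr_of_eventuallyEq
      (hev a b)
  have hdet := gramAt_det_ne_zero hh p
  have hgram : gramAt (n := n) (r := r) ht p = gramAt (n := n) h p := gramAt_deform h0 t
  have hW : ∀ (c : ℂ) (j : Fin n), wirtingerMatrix c j (gram (r := r) ht p) z₀ =
      wirtingerMatrix c j (gram (r := r) h p) z₀ := by
    intro c j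
    ext a b
    exact (wirtinger_congr (hev a b)).self_of_nhds.trans
      (wirtinger_add_sq_mul (hH a b) hFc (hM a b) hF0 t)
  have hWW : ∀ k j : Fin n,
      wirtingerMatrix Complex.I k (wirtingerMatrix (-Complex.I) j (gram (r := r) ht p)) z₀ =
      wirtingerMatrix Complex.I k (wirtingerMatrix (-Complex.I) j (gram h p)) z₀ +
        ((2 * t : ℂ) * (wirtinger Complex.I k F z₀ * wirtinger (-Complex.I) j F z₀)) •
          (gramAt (n := n) h p * endMatrix s p z₀) := by
    intro k j
    ext a b
    refine ((wirtinger_congr (wirtinger_congr (hev a b))).self_of_nhds.trans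
      (wirtinger_wirtinger_add_sq_mul (hH a b) hFc (hM a b) hF0 t)).trans ?_
    simp only [Matrix.add_apply, Matrix.smul_apply, smul_eq_mul]
    refine congrArg₂ (· + ·) rfl ?_
    rw [gramAt, ← hz₀]
    ring
  have hcoeff : ∀ k j : Fin n, curvatureCoeff (r := r) ht p k j = curvatureCoeff h p k j +
      ((2 * t : ℂ) * (wirtinger Complex.I k F z₀ * wirtinger (-Complex.I) j F z₀)) •
        endMatrix s p z₀ := by
    intro k j
    rw [curvatureCoeff_eq hHt (by rw [hgram]; exact hdet), curvatureCoeff_eq hH hdet, hgram,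
      ← hz₀, hW, hW, hWW, mul_add, mul_smul_comm,
      Matrix.nonsing_inv_mul_cancel_left _ _ (isUnit_iff_ne_zero.2 hdet)]
    abel
  have hfd := hf.differentiableAt two_ne_zero
  have htwo : twoForm (zeroOnePart ξ) (conjCovector (zeroOnePart ξ)) =
      ∑ k : Fin n, ∑ j : Fin n, (wirtinger Complex.I k F z₀ * wirtinger (-Complex.I) j F z₀) •
        twoForm (dzbar k) (dz j) := by
    rw [conjCovector_zeroOnePart, zeroOnePart, twoForm_sum_left]
    refine Finset.sum_congr rfl fun k _ => ?_
    rw [twoForm_sum_right, Finset.smul_sum]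
    refine Finset.sum_congr rfl fun j _ => ?_
    rw [smul_smul, hF, wirtinger_ofReal hfd, wirtinger_ofReal hfd, hξ]
  rw [htwo]
  simp only [centralCurvature, hcoeff, map_add, smul_add, Finset.sum_add_distrib, Finset.smul_sum,
    Finset.sum_smul]
  refine congrArg₂ (· + ·) rfl ?_
  refine Finset.sum_congr rfl fun k _ => Finset.sum_congr rfl fun j _ => ?_
  rw [map_smul, smul_smul, smul_comm, smul_assoc]

end Bundles

end ZCritical

end

noncomputable section

namespace ZCritical

open Filter Topology

/-! ## The principal symbol -/

section Symbol

variable {n r : ℕ} {X : Type*} [TopologicalSpace X] [ChartedSpace (Fin n → ℂ) X]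
  {V : X → Type*} [∀ x, AddCommGroup (V x)] [∀ x, Module ℂ (V x)]
  [∀ x, TopologicalSpace (V x)] [TopologicalSpace (Bundle.TotalSpace (Fin r → ℂ) V)]
  [FiberBundle (Fin r → ℂ) V]

theorem ChargeData.conjExt_kahlerAt (Ω : ChargeData n X) (p : X) :
    conjExt (Ω.kahlerAt p) = Ω.kahlerAt p := conjExt_toExt _

theorem ChargeData.conjExt_unipotentAt (Ω : ChargeData n X) (p : X) :
    conjExt (Ω.unipotentAt p) = Ω.unipotentAt p := by
  simp only [unipotentAt, map_sum, conjExt_toExt]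

theorem ChargeData.topCoeff_kahlerAt_ne_zero (Ω : ChargeData n X) (p : X) :
    topCoeff (Ω.kahlerAt p ^ n) ≠ 0 :=
  topCoeff_pow_ne_zero _ (Ω.kahler.type_one_one p) (Ω.kahler.pos p)

/-- The coefficient of `ω^n`, as a real number. -/
def ChargeData.volume (Ω : ChargeData n X) (p : X) : ℝ := (topCoeff (Ω.kahlerAt p ^ n)).re

theorem ChargeData.coe_volume (Ω : ChargeData n X) (p : X) :
    (Ω.volume p : ℂ) = topCoeff (Ω.kahlerAt p ^ n) := by
  rw [volume, ← Complex.conj_eq_iff_re, ← topCoeff_conjExt, map_pow, Ω.conjExt_kahlerAt]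

/-- The top coefficient of `ω^d ∧ U ∧ c` as a linear functional of `c`. -/
def ChargeData.functional (Ω : ChargeData n X) (p : X) (d : ℕ) : CentralForm n →ₗ[ℂ] ℂ :=
  topCoeff ∘ₗ LinearMap.mulLeft ℂ (Ω.kahlerAt p ^ d * Ω.unipotentAt p) ∘ₗ
    (Subalgebra.center ℂ (Ext n)).val.toLinearMap

theorem ChargeData.functional_apply (Ω : ChargeData n X) (p : X) (d : ℕ) (c : CentralForm n) :
    Ω.functional p d c = topCoeff (Ω.kahlerAt p ^ d * Ω.unipotentAt p * (c : Ext n)) := rfl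

theorem ChargeData.functional_conj (Ω : ChargeData n X) (p : X) (d : ℕ) (c : CentralForm n) :
    Ω.functional p d (conjCentral c) = starRingEnd ℂ (Ω.functional p d c) := by
  rw [functional_apply, functional_apply, ← topCoeff_conjExt, coe_conjCentral, map_mul conjExt,
    map_mul conjExt, map_pow conjExt, Ω.conjExt_kahlerAt, Ω.conjExt_unipotentAt]

theorem chernCharacterForm_eq (h : ∀ x, V x →ₗ⋆[ℂ] V x →ₗ[ℂ] ℂ) (p : X) :
    chernCharacterForm (n := n) (r := r) h p = extMatrix (expForm (centralCurvature h p)) := by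
  rw [chernCharacterForm, expForm, map_sum]
  refine Finset.sum_congr rfl fun j _ => ?_
  rw [curvature_eq, ← map_pow]
  rfl

theorem zForm_eq (Ω : ChargeData n X) (h : ∀ x, V x →ₗ⋆[ℂ] V x →ₗ[ℂ] ℂ) (p : X) :
    zForm (r := r) Ω h p =
      ∑ d : Fin (n + 1), Ω.ρ d • (expForm (centralCurvature h p)).map (Ω.functional p d) := by
  ext a b
  rw [zForm, chernCharacterForm_eq]
  simp only [Matrix.map_apply, Matrix.sum_apply, map_sum, Matrix.smul_apply, map_smul]
  rfl

/-- The Hermitian endomorphism with which the coefficient `ρ_d` enters the principal symbol. -/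
def symbolTerm (Ω : ChargeData n X) (h : ∀ x, V x →ₗ⋆[ℂ] V x →ₗ[ℂ] ℂ) (p : X) (w : Covector n)
    (S : Matrix (Fin r) (Fin r) ℂ) (d : ℕ) : Matrix (Fin r) (Fin r) ℂ :=
  (twoForm w (conjCovector w) • expVariation (centralCurvature (n := n) (r := r) h p)
    (constMatrix S)).map (Ω.functional p d)

/-- The principal symbol of the linearised Z-critical operator. -/
def symbolMatrix (Ω : ChargeData n X) (φ : ℝ) (h : ∀ x, V x →ₗ⋆[ℂ] V x →ₗ[ℂ] ℂ) (p : X)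
    (w : Covector n) (S : Matrix (Fin r) (Fin r) ℂ) : Matrix (Fin r) (Fin r) ℂ :=
  (Ω.volume p)⁻¹ • ∑ d : Fin (n + 1),
    (Complex.I * ((Complex.exp (-(Complex.I * φ)) * Ω.ρ d).im : ℂ)) • symbolTerm Ω h p w S d

theorem wordSum_add {R : Type*} [Ring R] (F S T : R) (i : ℕ) :
    wordSum F (S + T) i = wordSum F S i + wordSum F T i := by
  simp only [wordSum, mul_add, add_mul, Finset.sum_add_distrib]

theorem wordSum_smul {R : Type*} [Ring R] [Algebra ℂ R] (F S : R) (c : ℂ) (i : ℕ) :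
    wordSum F (c • S) i = c • wordSum F S i := by
  simp only [wordSum, mul_smul_comm, smul_mul_assoc, Finset.smul_sum]

theorem symbolTerm_add (Ω : ChargeData n X) (h : ∀ x, V x →ₗ⋆[ℂ] V x →ₗ[ℂ] ℂ) (p : X)
    (w : Covector n) (S T : Matrix (Fin r) (Fin r) ℂ) (d : ℕ) :
    symbolTerm Ω h p w (S + T) d = symbolTerm Ω h p w S d + symbolTerm Ω h p w T d := by
  rw [symbolTerm, map_add, expVariation]
  simp only [wordSum_add, smul_add, Finset.sum_add_distrib]
  exact Matrix.map_add (Ω.functional p d) (map_add _) _ _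

theorem symbolTerm_smul (Ω : ChargeData n X) (h : ∀ x, V x →ₗ⋆[ℂ] V x →ₗ[ℂ] ℂ) (p : X)
    (w : Covector n) (S : Matrix (Fin r) (Fin r) ℂ) (c : ℂ) (d : ℕ) :
    symbolTerm Ω h p w (c • S) d = c • symbolTerm Ω h p w S d := by
  rw [symbolTerm, map_smul, expVariation]
  simp only [wordSum_smul, smul_comm _ c, ← Finset.smul_sum]
  exact Matrix.map_smul (Ω.functional p d) c (map_smul _ c) _

/-! ### Comparison with the subsolution form -/

/-- A Hermitian `S` is its own adjoint, so only the covector is conjugated. -/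
theorem adjointOneForm_eq {H S : Matrix (Fin r) (Fin r) ℂ} (hdet : H.det ≠ 0)
    (hS : S ∈ hermEnd H) (w : Covector n) :
    adjointOneForm H (Matrix.of fun a b => S a b • w) =
      Matrix.of fun a b => S a b • conjCovector w := by
  have hS' : Sᴴ * H = H * S := hS
  have h1 : H⁻¹ * (Sᴴ * H) = S := by
    rw [hS', Matrix.nonsing_inv_mul_cancel_left _ _ (isUnit_iff_ne_zero.2 hdet)]
  refine Matrix.ext fun a b => ?_
  simp only [adjointOneForm, Matrix.of_apply, conjCovector_smul, smul_smul, ← Finset.sum_smul]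
  refine congrArg (· • conjCovector w) ?_
  conv_rhs => rw [← h1]
  simp only [Matrix.mul_apply, Finset.mul_sum, Matrix.conjTranspose_apply]
  refine Finset.sum_congr rfl fun c _ => Finset.sum_congr rfl fun d _ => ?_
  simp only [Complex.star_def]
  ring

theorem map_oneForm_smul (S : Matrix (Fin r) (Fin r) ℂ) (w : Covector n) :
    (Matrix.of fun a b => S a b • w).map oneForm =
      oneForm w • extMatrix (constMatrix (n := n) S) := by
  ext a b
  change oneForm (S a b • w) = oneForm w * algebraMap ℂ (Ext n) (S a b)
  rw [← Algebra.commutes, ← Algebra.smul_def]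
  exact map_smul (ExteriorAlgebra.ι ℂ) _ _

/-- The `i + 1` equal brackets, one for each position of the empty slot, cancel the factor `1 / (i +
1)` of `symBracket_trace`. -/
theorem subsolutionForm_eq (Ω : ChargeData n X) (φ : ℝ) {h : ∀ x, V x →ₗ⋆[ℂ] V x →ₗ[ℂ] ℂ} {p : X}
    (hdet : (gramAt (n := n) (r := r) h p).det ≠ 0) {S : Matrix (Fin r) (Fin r) ℂ}
    (hS : S ∈ hermEnd (gramAt (n := n) (r := r) h p)) (w : Covector n) :
    subsolutionForm Ω φ h p (Matrix.of fun a b => S a b • w) =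
      ∑ d : Fin (n + 1), ((Complex.exp (-(Complex.I * φ)) * Ω.ρ d).im : ℂ) *
        (symbolTerm Ω h p w S d * S).trace := by
  rw [subsolutionForm, adjointOneForm_eq hdet hS, map_oneForm_smul, map_oneForm_smul, curvature_eq]
  simp only [symBracket_trace, map_sum]
  refine Finset.sum_congr rfl fun d _ => ?_
  rw [symbolTerm, trace_map_mul, expVariation, Finset.smul_sum, Finset.sum_mul, Matrix.trace_sum,
    map_sum, Finset.mul_sum]
  refine Finset.sum_congr rfl fun i _ => ?_
  have hi : (i : ℂ) + 1 ≠ 0 := by exact_mod_cast Nat.succ_ne_zero i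
  rw [smul_mul_assoc, smul_mul_assoc, Matrix.trace_smul, Matrix.trace_smul, smul_eq_mul,
    mul_smul_comm, map_smul, map_smul, smul_eq_mul, Finset.sum_const, Finset.card_univ,
    Fintype.card_fin, Ω.functional_apply]
  refine (congrArg₂ (· * ·) rfl (congrArg (fun x => topCoeff (_ * x)) ?_)).trans (mul_assoc _ _ _)
  rw [← Nat.cast_smul_eq_nsmul ℂ]
  change ((i + 1 : ℕ) : ℂ) • (((i : ℂ) + 1)⁻¹ • (_ : Ext n)) = _
  rw [smul_smul, Nat.cast_succ, mul_inv_cancel₀ hi, one_smul]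

/-- The bridge between ellipticity and subsolutions: if the symbol annihilates `S`, the subsolution
form vanishes at `S ⊗ w`. -/
theorem trace_symbolMatrix_mul (Ω : ChargeData n X) (φ : ℝ)
    {h : ∀ x, V x →ₗ⋆[ℂ] V x →ₗ[ℂ] ℂ} {p : X}
    (hdet : (gramAt (n := n) (r := r) h p).det ≠ 0) {S : Matrix (Fin r) (Fin r) ℂ}
    (hS : S ∈ hermEnd (gramAt (n := n) (r := r) h p)) (w : Covector n) :
    (symbolMatrix Ω φ h p w S * S).trace = ((Ω.volume p)⁻¹ : ℂ) * Complex.I *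
      subsolutionForm Ω φ h p (Matrix.of fun a b => S a b • w) := by
  rw [subsolutionForm_eq Ω φ hdet hS, symbolMatrix, smul_mul_assoc, Matrix.trace_smul,
    Finset.sum_mul, Matrix.trace_sum, Complex.real_smul, Complex.ofReal_inv, mul_assoc]
  refine congrArg₂ (· * ·) rfl ?_
  rw [Finset.mul_sum]
  refine Finset.sum_congr rfl fun d _ => ?_
  rw [smul_mul_assoc, Matrix.trace_smul, smul_eq_mul, mul_assoc]

variable [VectorBundle ℂ (Fin r → ℂ) V] {h : ∀ x, V x →ₗ⋆[ℂ] V x →ₗ[ℂ] ℂ}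

theorem symbolTerm_mem_hermEnd (Ω : ChargeData n X)
    (hh : IsHermitianMetric (n := n) (r := r) h) {p : X} (w : Covector n)
    {S : Matrix (Fin r) (Fin r) ℂ} (hS : S ∈ hermEnd (gramAt (n := n) (r := r) h p)) (d : ℕ) :
    symbolTerm Ω h p w S d ∈ hermEnd (gramAt (n := n) (r := r) h p) :=
  map_mem_hermEnd _ (Ω.functional_conj p d)
    (conjTransposeForm_expVariation (conjTransposeForm_centralCurvature hh p) hS w)

theorem symbolMatrix_mem_skewEnd (Ω : ChargeData n X) (φ : ℝ)
    (hh : IsHermitianMetric (n := n) (r := r) h) {p : X} (w : Covector n)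
    {S : Matrix (Fin r) (Fin r) ℂ} (hS : S ∈ hermEnd (gramAt (n := n) (r := r) h p)) :
    symbolMatrix Ω φ h p w S ∈ skewEnd (gramAt (n := n) (r := r) h p) :=
  Submodule.smul_mem _ _ (Submodule.sum_mem _ fun d _ =>
    I_smul_mem_skewEnd (symbolTerm_mem_hermEnd Ω hh w hS d) _)

/-- The principal symbol as a linear map between the spaces of Hermitian and of skew-Hermitian
endomorphisms. -/
def symbolMap (Ω : ChargeData n X) (φ : ℝ) (hh : IsHermitianMetric (n := n) (r := r) h) (p : X)
    (w : Covector n) :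
    hermEnd (gramAt (n := n) (r := r) h p) →ₗ[ℝ] skewEnd (gramAt (n := n) (r := r) h p) where
  toFun S := ⟨symbolMatrix Ω φ h p w S, symbolMatrix_mem_skewEnd Ω φ hh w S.2⟩
  map_add' S T := Subtype.ext (by
    simp only [symbolMatrix, Submodule.coe_add, symbolTerm_add, smul_add, Finset.sum_add_distrib])
  map_smul' c S := Subtype.ext (by
    have h1 : ((c • S : hermEnd (gramAt (n := n) (r := r) h p)) : Matrix (Fin r) (Fin r) ℂ) =
        (c : ℂ) • (S : Matrix (Fin r) (Fin r) ℂ) := by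
      ext a b; simp
    have h2 : ∀ M : Matrix (Fin r) (Fin r) ℂ, (c : ℂ) • M = c • M := fun M => by ext a b; simp
    simp only [symbolMatrix, h1, symbolTerm_smul, smul_comm _ (c : ℂ), ← Finset.smul_sum]
    exact h2 _)

theorem zForm_deform (Ω : ChargeData n X) (hh : IsHermitianMetric (n := n) (r := r) h)
    {f : X → ℝ} {s : ∀ x, V x →ₗ[ℂ] V x} {p : X} {ξ : (Fin n → ℂ) →L[ℝ] ℝ}
    (hs : IsHermitianSection (n := n) (r := r) h s) (h0 : f p = 0)
    (hf : ContDiffAt ℝ 2 (f ∘ (chartAt (Fin n → ℂ) p).symm) (chartAt (Fin n → ℂ) p p))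
    (hξ : fderiv ℝ (f ∘ (chartAt (Fin n → ℂ) p).symm) (chartAt (Fin n → ℂ) p p) = ξ) (t : ℝ) :
    zForm (r := r) Ω (deform h (fun x => ((f x : ℂ) ^ 2) • s x) t) p =
      zForm Ω h p + (t : ℂ) • (2 : ℂ) • ∑ d : Fin (n + 1), Ω.ρ d •
        symbolTerm Ω h p (zeroOnePart ξ) (endMatrix s p (chartAt (Fin n → ℂ) p p)) d := by
  have hsq : ((2 * t : ℂ) • twoForm (zeroOnePart ξ) (conjCovector (zeroOnePart ξ))) *
      ((2 * t : ℂ) • twoForm (zeroOnePart ξ) (conjCovector (zeroOnePart ξ))) = 0 := by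
    rw [smul_mul_smul_comm, twoForm_mul_self, smul_zero]
  rw [zForm_eq, zForm_eq, centralCurvature_deform hh hs h0 hf hξ, expForm_add_smul hsq, smul_smul,
    Finset.smul_sum, ← Finset.sum_add_distrib]
  refine Finset.sum_congr rfl fun d _ => ?_
  rw [Matrix.map_add _ (map_add _), smul_add, smul_assoc,
    Matrix.map_smul _ _ (map_smul _ _), smul_comm (Ω.ρ d), mul_comm (2 : ℂ)]
  rfl

theorem linearisation_sq_smul (Ω : ChargeData n X) (φ : ℝ)
    (hh : IsHermitianMetric (n := n) (r := r) h)
    {f : X → ℝ} {s : ∀ x, V x →ₗ[ℂ] V x} {p : X} {ξ : (Fin n → ℂ) →L[ℝ] ℝ}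
    (hs : IsHermitianSection (n := n) (r := r) h s) (h0 : f p = 0)
    (hf : ContDiffAt ℝ 2 (f ∘ (chartAt (Fin n → ℂ) p).symm) (chartAt (Fin n → ℂ) p p))
    (hξ : fderiv ℝ (f ∘ (chartAt (Fin n → ℂ) p).symm) (chartAt (Fin n → ℂ) p p) = ξ)
    (hS : endMatrix s p (chartAt (Fin n → ℂ) p p) ∈ hermEnd (gramAt (n := n) (r := r) h p)) :
    linearisation (r := r) Ω φ h (fun x => ((f x : ℂ) ^ 2) • s x) p = (2 : ℝ) •
      symbolMatrix Ω φ h p (zeroOnePart ξ) (endMatrix s p (chartAt (Fin n → ℂ) p p)) := by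
  set e := Complex.exp (-(Complex.I * φ)) with he
  set S := endMatrix (r := r) s p (chartAt (Fin n → ℂ) p p) with hSdef
  have hdet := gramAt_det_ne_zero hh p
  have h1 : imPart (gramAt (n := n) h p)
      (e • (2 : ℂ) • ∑ d : Fin (n + 1), Ω.ρ d • symbolTerm Ω h p (zeroOnePart ξ) S d) =
      (2 : ℂ) • ∑ d : Fin (n + 1), (Complex.I * ((e * Ω.ρ d).im : ℂ)) •
        symbolTerm Ω h p (zeroOnePart ξ) S d := by
    rw [smul_comm e, show (2 : ℂ) = ((2 : ℝ) : ℂ) by norm_num, imPart_real_smul, Finset.smul_sum,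
      imPart_sum]
    congr 1
    refine Finset.sum_congr rfl fun d _ => ?_
    rw [smul_smul, imPart_smul_of_mem_hermEnd hdet (symbolTerm_mem_hermEnd Ω hh _ hS d)]
  -- The operator along the deformation is affine in `t`, so its derivative at `0` is the
  -- coefficient of `t`. The metric at `p` is unchanged, so the skew part is taken with respect to a
  -- fixed form.
  have h2 : ∀ t : ℝ, zOperator (r := r) Ω φ (deform h (fun x => ((f x : ℂ) ^ 2) • s x) t) p =
      zOperator Ω φ h p + (t : ℂ) • (2 : ℂ) • symbolMatrix Ω φ h p (zeroOnePart ξ) S := by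
    intro t
    rw [zOperator, zForm_deform Ω hh hs h0 hf hξ, gramAt_deform h0, smul_add, imPart_add,
      smul_comm _ (t : ℂ), imPart_real_smul, h1, smul_add, zOperator, symbolMatrix,
      ← Ω.coe_volume]
    congr 1
    ext a b
    simp
    ring
  ext a b
  rw [linearisation, Matrix.of_apply]
  have h3 : (fun t : ℝ => zOperator (r := r) Ω φ
      (deform h (fun x => ((f x : ℂ) ^ 2) • s x) t) p a b) =
      fun t : ℝ => zOperator (r := r) Ω φ h p a b +
        (t : ℂ) * (2 * symbolMatrix Ω φ h p (zeroOnePart ξ) S a b) := by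
    funext t
    rw [h2]
    simp
  rw [h3]
  have h4 := ((Complex.ofRealCLM.hasDerivAt (x := (0 : ℝ))).mul_const
    (2 * symbolMatrix Ω φ h p (zeroOnePart ξ) S a b)).const_add
      (zOperator (r := r) Ω φ h p a b)
  refine (h4.deriv).trans ?_
  simp

theorem isPrincipalSymbol_symbolMap (Ω : ChargeData n X) (φ : ℝ)
    (hh : IsHermitianMetric (n := n) (r := r) h) (p : X) (ξ : (Fin n → ℂ) →L[ℝ] ℝ) :
    IsPrincipalSymbol h (linearisation Ω φ h) p ξ (symbolMap Ω φ hh p (zeroOnePart ξ)) := by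
  intro f s v hf h0 hξ hs hv
  have hfc : ContDiffAt ℝ 2 (f ∘ (chartAt (Fin n → ℂ) p).symm) (chartAt (Fin n → ℂ) p p) := by
    have := (hf.contMDiffAt (x := p))
    rw [contMDiffAt_iff] at this
    have h2 := this.2
    simp only [mfld_simps, contDiffWithinAt_univ] at h2
    exact h2.of_le (WithTop.coe_le_coe.2 le_top)
  rw [linearisation_sq_smul Ω φ hh hs h0 hfc hξ (by rw [hv]; exact v.2), hv]
  rfl

/-- For a nonzero `S` in the kernel, `S ⊗ w` would be a nonzero `(0,1)`-covector at which the
subsolution form vanishes. -/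
theorem symbolMap_bijective (Ω : ChargeData n X) (φ : ℝ)
    (hh : IsHermitianMetric (n := n) (r := r) h) (p : X) {w : Covector n} (hw : IsZeroOne w)
    (hw0 : w ≠ 0)
    (hsub : ∀ u : Matrix (Fin r) (Fin r) (Covector n), (∀ a b, IsZeroOne (u a b)) → u ≠ 0 →
      subsolutionForm Ω φ h p u ≠ 0) :
    Function.Bijective (symbolMap Ω φ hh p w) := by
  have hinj : Function.Injective (symbolMap Ω φ hh p w) := by
    rw [← LinearMap.ker_eq_bot, LinearMap.ker_eq_bot']
    intro S hS
    by_contra hS0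
    have hzero : symbolMatrix Ω φ h p w (S : Matrix (Fin r) (Fin r) ℂ) = 0 :=
      congrArg Subtype.val hS
    have htr := trace_symbolMatrix_mul Ω φ (gramAt_det_ne_zero hh p) S.2 w
    rw [hzero, zero_mul, Matrix.trace_zero] at htr
    refine hsub (Matrix.of fun a b => (S : Matrix (Fin r) (Fin r) ℂ) a b • w) (fun a b v => ?_)
      (fun hu => ?_) ?_
    · simp only [Matrix.of_apply, LinearMap.smul_apply, hw v, smul_eq_mul]
      ring
    · apply hS0
      ext a b
      have := congrFun (congrFun hu a) b
      exact (smul_eq_zero.1 this).resolve_right hw0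
    · have hv : (Ω.volume p : ℂ) ≠ 0 := by
        rw [Ω.coe_volume]
        exact Ω.topCoeff_kahlerAt_ne_zero p
      exact (mul_eq_zero.1 htr.symm).resolve_left (mul_ne_zero (inv_ne_zero hv) Complex.I_ne_zero)
  exact ⟨hinj, (LinearMap.injective_iff_surjective_of_finrank_eq_finrank
    (finrank_hermEnd_eq _)).1 hinj⟩

end Symbol

/-! ## Functions with prescribed differential -/

section Bump

variable {n : ℕ} {X : Type*} [TopologicalSpace X] [ChartedSpace (Fin n → ℂ) X]

theorem isManifold_real [IsManifold 𝓘(ℂ, Fin n → ℂ) ω X] : IsManifold 𝓘(ℝ, Fin n → ℂ) ∞ X := by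
  refine isManifold_of_contDiffOn _ _ _ fun e e' he he' => ?_
  have h := (contDiffGroupoid ω 𝓘(ℂ, Fin n → ℂ)).compatible he he'
  rw [contDiffGroupoid, mem_groupoid_of_pregroupoid] at h
  have h1 := h.1
  simp only [contDiffPregroupoid, mfld_simps] at h1 ⊢
  exact (h1.restrict_scalars ℝ).of_le (by exact le_top)

/-- The real-linear function `ξ` in the chart, centred at `p`, is cut off by a bump function equal
to `1` near `p`. Such functions make the defining property of a principal symbol restrictive, which
the converse requires. -/
theorem exists_contMDiff_fderiv_eq [T2Space X] [IsManifold 𝓘(ℂ, Fin n → ℂ) ω X] (p : X)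
    (ξ : (Fin n → ℂ) →L[ℝ] ℝ) :
    ∃ f : X → ℝ, ContMDiff 𝓘(ℝ, Fin n → ℂ) 𝓘(ℝ, ℝ) ∞ f ∧ f p = 0 ∧
      fderiv ℝ (f ∘ (chartAt (Fin n → ℂ) p).symm) (chartAt (Fin n → ℂ) p p) = ξ := by
  have : IsManifold 𝓘(ℝ, Fin n → ℂ) ∞ X := isManifold_real
  obtain ⟨b⟩ : Nonempty (SmoothBumpFunction 𝓘(ℝ, Fin n → ℂ) p) := inferInstance
  set e := chartAt (Fin n → ℂ) p with he
  have hg : ContMDiffOn 𝓘(ℝ, Fin n → ℂ) 𝓘(ℝ, ℝ) ∞ (fun x => ξ (e x - e p)) e.source := by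
    have h1 : ContMDiffOn 𝓘(ℝ, Fin n → ℂ) 𝓘(ℝ, Fin n → ℂ) ∞ e e.source := contMDiffOn_chart
    have h2 : ContDiff ℝ ∞ fun z => ξ (z - e p) := ξ.contDiff.comp (contDiff_id.sub contDiff_const)
    exact h2.contMDiff.comp_contMDiffOn h1
  refine ⟨fun x => b x • ξ (e x - e p), b.contMDiff_smul hg, by simp, ?_⟩
  have hev : ((fun x => b x • ξ (e x - e p)) ∘ e.symm) =ᶠ[𝓝 (e p)] fun z => ξ (z - e p) := by
    have h1 : Tendsto e.symm (𝓝 (e p)) (𝓝 p) := by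
      have := e.continuousAt_symm (mem_chart_target (Fin n → ℂ) p)
      rwa [ContinuousAt, e.left_inv (mem_chart_source (Fin n → ℂ) p)] at this
    filter_upwards [h1.eventually b.eventuallyEq_one,
      e.open_target.mem_nhds (mem_chart_target (Fin n → ℂ) p)] with z hz hz'
    simp only [Function.comp_apply, hz, e.right_inv hz', Pi.one_apply, one_smul]
  rw [hev.fderiv_eq]
  have : HasFDerivAt (fun z => ξ (z - e p)) ξ (e p) := by
    exact ξ.hasFDerivAt.comp (e p) ((hasFDerivAt_id (e p)).sub_const (e p))
  exact this.fderiv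

end Bump

/-! ### The identity endomorphism as a Hermitian test section. -/

section Identity

variable {n r : ℕ} {X : Type*} [TopologicalSpace X] [ChartedSpace (Fin n → ℂ) X]
  {V : X → Type*} [∀ x, AddCommGroup (V x)] [∀ x, Module ℂ (V x)]
  [∀ x, TopologicalSpace (V x)] [TopologicalSpace (Bundle.TotalSpace (Fin r → ℂ) V)]
  [FiberBundle (Fin r → ℂ) V]

theorem endMatrix_id {p : X} {z : Fin n → ℂ} (hz : z ∈ coordDomain (r := r) V p) :
    endMatrix (r := r) (fun x => (LinearMap.id : V x →ₗ[ℂ] V x)) p z = 1 := by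
  ext a b
  simp only [endMatrix, Matrix.of_apply, LinearMap.id_apply, frame]
  rw [Bundle.Trivialization.apply_mk_symm _ hz.2, Matrix.one_apply]
  exact Pi.single_apply _ _ _

theorem isHermitianSection_id (h : ∀ x, V x →ₗ⋆[ℂ] V x →ₗ[ℂ] ℂ) :
    IsHermitianSection (n := n) (r := r) h fun _ => LinearMap.id where
  selfAdjoint _ _ _ := rfl
  smooth p a b := (contDiffOn_const (c := (1 : Matrix (Fin r) (Fin r) ℂ) a b)).congr
    fun z hz => by rw [endMatrix_id hz]

end Identity

end ZCritical

end

/-! ### The theorem: subsolutions are elliptic, with the converse in rank one. -/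

open ZCritical in
theorem mainTheorem5 {n r : ℕ} {X : Type*} [TopologicalSpace X] [T2Space X] [CompactSpace X]
    [ChartedSpace (Fin n → ℂ) X] [IsManifold 𝓘(ℂ, Fin n → ℂ) ω X]
    {V : X → Type*} [∀ x, AddCommGroup (V x)] [∀ x, Module ℂ (V x)]
    [∀ x, TopologicalSpace (V x)] [TopologicalSpace (Bundle.TotalSpace (Fin r → ℂ) V)]
    [FiberBundle (Fin r → ℂ) V] [VectorBundle ℂ (Fin r → ℂ) V]
    [ContMDiffVectorBundle ω (Fin r → ℂ) V 𝓘(ℂ, Fin n → ℂ)]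
    (Ω : ZCritical.ChargeData n X) (h : ∀ x, V x →ₗ⋆[ℂ] V x →ₗ[ℂ] ℂ)
    (hh : ZCritical.IsHermitianMetric (n := n) (r := r) h)
    (hZ : ZCritical.centralCharge (r := r) Ω h ≠ 0) :
    (ZCritical.IsSubsolution (r := r) Ω h → ZCritical.IsEllipticAt (r := r) Ω h) ∧
      (r = 1 → (ZCritical.IsEllipticAt (r := r) Ω h ↔ ZCritical.IsSubsolution (r := r) Ω h)) := by
  have hfwd : ZCritical.IsSubsolution (r := r) Ω h → ZCritical.IsEllipticAt (r := r) Ω h :=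
    fun hsub p ξ hξ => ⟨symbolMap Ω _ hh p (zeroOnePart ξ), isPrincipalSymbol_symbolMap Ω _ hh p ξ,
      symbolMap_bijective Ω _ hh p (isZeroOne_zeroOnePart ξ) (zeroOnePart_ne_zero hξ) (hsub p)⟩
  refine ⟨hfwd, fun hr => ⟨fun hell p u hu hu0 hform => ?_, hfwd⟩⟩
  subst hr
  obtain ⟨ξ, hξ⟩ := exists_zeroOnePart_eq (hu 0 0)
  -- In rank one `u` is a single `(0,1)`-covector, hence the identity tensored with the `(0,1)`-part
  -- of a real `ξ`.
  have hu1 : u = Matrix.of fun a b => (1 : Matrix (Fin 1) (Fin 1) ℂ) a b • zeroOnePart ξ := by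
    ext a b : 2
    rw [Subsingleton.elim a 0, Subsingleton.elim b 0, hξ]
    simp
  have hξ0 : ξ ≠ 0 := by
    rintro rfl
    apply hu0
    rw [hu1]
    ext a b : 2
    simp [zeroOnePart]
  obtain ⟨σ, hσ, hbij⟩ := hell p ξ hξ0
  obtain ⟨f, hf, hf0, hfξ⟩ := exists_contMDiff_fderiv_eq p ξ
  have hone : (1 : Matrix (Fin 1) (Fin 1) ℂ) ∈ hermEnd (gramAt (n := n) (r := 1) h p) := by
    change (1 : Matrix (Fin 1) (Fin 1) ℂ)ᴴ * _ = _ * 1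
    simp
  have hid := isHermitianSection_id (n := n) (r := 1) h
  have h1 := hσ f _ ⟨1, hone⟩ hf hf0 hfξ hid (endMatrix_id (mem_coordDomain p))
  have h2 := isPrincipalSymbol_symbolMap Ω (phase (r := 1) Ω h) hh p ξ f _ ⟨1, hone⟩ hf hf0 hfξ hid
    (endMatrix_id (mem_coordDomain p))
  -- Testing on `f² • id` determines the symbol at the identity, so the one supplied by ellipticity
  -- agrees there with the computed one.
  have h3 : (σ ⟨1, hone⟩ : Matrix (Fin 1) (Fin 1) ℂ) =
      symbolMatrix Ω (phase (r := 1) Ω h) h p (zeroOnePart ξ) 1 :=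
    smul_right_injective _ (two_ne_zero' ℝ) (h1.symm.trans h2)
  have htr := trace_symbolMatrix_mul Ω (phase (r := 1) Ω h) (gramAt_det_ne_zero hh p) hone
    (zeroOnePart ξ)
  rw [← hu1, hform, mul_zero, mul_one, ← h3, Matrix.trace_fin_one] at htr
  -- A `1 × 1` matrix is determined by its trace, which vanishes with the subsolution form; this
  -- contradicts injectivity of `σ`.
  have h4 : σ ⟨1, hone⟩ = 0 := by
    ext a b
    rw [Subsingleton.elim a 0, Subsingleton.elim b 0, htr]
    rfl
  have h5 := congrArg Subtype.val (hbij.1 (h4.trans (map_zero σ).symm))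
  exact one_ne_zero h5
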